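/- Let $\mathbb{F}_q$ be a finite field of characteristic $p > 3$ with algebraic closure $\overline{\mathbb{F}}_q$, and let $\mathcal{G} = \mathrm{Gal}(\overline{\mathbb{F}}_q/\mathbb{F}_q)$. Let $H$ be the hyperelliptic curve of genus $3$ over $\mathbb{F}_q$ with affine model $y^2 = F(x)$, where $F \in \mathbb{F}_q[x]$ is squarefree of degree $7$ or $8$, and with weighted projective plane model $w^2 = \widetilde{F}(u,v)$, where $\widetilde{F}(u,v) = v^8F(u/v)$ and $u, v, w$ have weights $1, 1, 4$. The Weierstrass points of $H$ are its eight points over $\overline{\mathbb{F}}_q$ with $w = 0$. Identify $J_H(\overline{\mathbb{F}}_q)$ with $\mathrm{Pic}^0(H)$, the group of divisors of degree $0$ on $H$ over $\overline{\mathbb{F}}_q$ modulo principal divisors, with its action of $\mathcal{G}$ induced by the action on points. Let $\pi$ be a partition of the set of the eight Weierstrass points of $H$ into four disjoint pairs which is stable under $\mathcal{G}$ (that is, every $\sigma \in \mathcal{G}$ maps pairs of $\pi$ to pairs of $\pi$). Let $S$ be the subgroup of $J_H(\overline{\mathbb{F}}_q)$ generated by the classes $[(W') - (W'')]$ with $\{W',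 W''\} \in \pi$. Then: 1. $S$ is contained in the $2$-torsion subgroup $J_H[2](\overline{\mathbb{F}}_q)$. 2. $S$ is $\mathbb{F}_q$-rational, that is, $\sigma(S) = S$ for every $\sigma \in \mathcal{G}$. 3. $S$ is isomorphic to $(\mathbb{Z}/2\mathbb{Z})^3$ as a group. 4. If $\pi = \{\{W_1', W_1''\}, \{W_2', W_2''\}, \{W_3', W_3''\}, \{W_4', W_4''\}\}$ and $e_i = [(W_i') - (W_i'')]$, then $S = \langle e_1, e_2, e_3, e_4 \rangle$ and $e_1 + e_2 + e_3 + e_4 = 0$, and this is the only relation among these $2$-torsion classes: for integers $n_1, \dots, n_4$ one has $\sum_i n_i e_i = 0$ if and only if $n_1, \dots, n_4$ all have the same parity. -/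

import Mathlib

open Polynomial

/-- A hyperelliptic curve of genus `3` over a field `K` (of characteristic not `2`), given by an
affine model `y² = F(x)` with `F` squarefree of degree `7` or `8` (not necessarily monic). -/
structure HyperellipticCurve3 (K : Type*) [Field K] where
  /-- The hyperelliptic polynomial. -/
  F : K[X]
  squarefree : Squarefree F
  natDegree_eq : F.natDegree = 7 ∨ F.natDegree = 8

namespace HyperellipticCurve3

noncomputable section

section Geometry

/-! ### Points, functions and divisors

In this section the field `K` is to be thought of as algebraically closed: the points of the curve
are its `K`-rational points and divisors are formal sums of such points. -/

variable {K : Type*} [Field K] (H : HyperellipticCurve3 K)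

/-- The binary form `F̃(u, v) = v⁸ F(u / v)` of degree `8`. -/
def form : MvPolynomial (Fin 2) K := H.F.homogenize 8

/-- A nonzero triple `(u, v, w)` with `w² = F̃(u, v)`: homogeneous coordinates of a point of the
weighted projective plane model of the curve. -/
def Triple : Type _ :=
  {p : Fin 3 → K // p ≠ 0 ∧ p 2 ^ 2 = MvPolynomial.eval ![p 0, p 1] H.form}

/-- `(u, v, w)` and `(c u, c v, c⁴ w)` are homogeneous coordinates of the same point of the
weighted projective plane `ℙ(1, 1, 4)`. -/
instance tripleSetoid : Setoid H.Triple where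
  r p q := ∃ c : Kˣ, q.1 = ![c * p.1 0, c * p.1 1, c ^ 4 * p.1 2]
  iseqv :=
    { refl := fun p => ⟨1, by ext i; fin_cases i <;> simp⟩
      symm := by
        rintro p q ⟨c, h⟩
        refine ⟨c⁻¹, ?_⟩
        rw [h]
        ext i; fin_cases i <;> simp
      trans := by
        rintro p q r ⟨c, h⟩ ⟨d, h'⟩
        refine ⟨d * c, ?_⟩
        rw [h', h]
        ext i; fin_cases i <;> simp <;> ring }

/-- The set `H(K)` of points `(u : v : w)` of the curve. -/
def Point : Type _ := Quotient H.tripleSetoid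

/-- The Weierstrass points: the points `(u : v : w)` with `w = 0`. -/
def weierstrassPoints : Set H.Point :=
  {P | ∃ p : H.Triple, (⟦p⟧ : H.Point) = P ∧ p.1 2 = 0}

/-- The polynomial `y² - F(x)`, as a polynomial in `y` over `K[x]`. -/
def equation : K[X][X] := X ^ 2 - C H.F

/-- The coordinate ring `K[x, y] / (y² - F(x))` of the affine model. -/
abbrev CoordinateRing : Type _ := AdjoinRoot H.equation

theorem not_isSquare_F : ¬ IsSquare H.F := by
  rintro ⟨g, hg⟩
  have hu : IsUnit g := H.squarefree g ⟨1, by rw [hg, mul_one]⟩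
  have h0 : g.natDegree = 0 := natDegree_eq_zero_of_isUnit hu
  have h1 : H.F.natDegree = g.natDegree + g.natDegree := by
    rw [hg, natDegree_mul hu.ne_zero hu.ne_zero]
  rcases H.natDegree_eq with h | h <;> omega

theorem prime_equation : Prime H.equation := by
  refine Irreducible.prime ?_
  have hm : H.equation.Monic := monic_X_pow_sub_C _ two_ne_zero
  have hd : H.equation.natDegree = 2 := natDegree_X_pow_sub_C
  rw [hm.irreducible_iff_roots_eq_zero_of_degree_le_three (by omega) (by omega)]
  refine Multiset.eq_zero_of_forall_notMem fun g hg => H.not_isSquare_F ⟨g, ?_⟩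
  have h := (mem_roots'.mp hg).2
  simp only [equation, IsRoot.def, eval_sub, eval_pow, eval_X, eval_C] at h
  rw [← pow_two]
  exact (sub_eq_zero.mp h).symm

instance : IsDomain H.CoordinateRing := AdjoinRoot.isDomain_of_prime H.prime_equation

/-- The function field `K(H) = K(x)[y] / (y² - F(x))`. -/
abbrev FunctionField : Type _ := FractionRing H.CoordinateRing

/-- The function `x = u / v`. -/
def x : H.FunctionField := algebraMap H.CoordinateRing H.FunctionField (AdjoinRoot.of H.equation X)

/-- The function `y = w / v⁴`. -/
def y : H.FunctionField := algebraMap H.CoordinateRing H.FunctionField (AdjoinRoot.root H.equation)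

/-- The inclusion of the constants in the function field. -/
def const : K →+* H.FunctionField :=
  (algebraMap H.CoordinateRing H.FunctionField).comp ((AdjoinRoot.of H.equation).comp C)

/-- The function `G(x, 1, y)`; it is the function `G / vᵈ` if `G(u, v, w)` is weighted
homogeneous of degree `d`. -/
def dehomogenize : MvPolynomial (Fin 3) K →+* H.FunctionField :=
  MvPolynomial.eval₂Hom H.const ![H.x, 1, H.y]

/-- A polynomial in `u, v, w` that is weighted homogeneous of degree `d`, where `u, v, w` have
weights `1, 1, 4`. -/
def IsForm (G : MvPolynomial (Fin 3) K) (d : ℕ) : Prop :=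
  G.IsWeightedHomogeneous (![1, 1, 4] : Fin 3 → ℕ) d

/-- A form does not vanish at a point. -/
def NonvanishingAt (G : MvPolynomial (Fin 3) K) (P : H.Point) : Prop :=
  ∀ p : H.Triple, (⟦p⟧ : H.Point) = P → MvPolynomial.eval p.1 G ≠ 0

/-- The local ring of the curve at `P`: all functions `A / B` with forms `A` and `B` of the same
degree such that `B` does not vanish at `P`. -/
def localRing (P : H.Point) : Subring H.FunctionField where
  carrier := {f | ∃ (d : ℕ) (A B : MvPolynomial (Fin 3) K), IsForm A d ∧ IsForm B d ∧
    H.NonvanishingAt B P ∧ f = H.dehomogenize A / H.dehomogenize B}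
  one_mem' := by
    refine ⟨0, 1, 1, MvPolynomial.isWeightedHomogeneous_one _ _,
      MvPolynomial.isWeightedHomogeneous_one _ _, fun p _ => by simp, by simp⟩
  zero_mem' := by
    refine ⟨0, 0, 1, MvPolynomial.isWeightedHomogeneous_zero _ _ _,
      MvPolynomial.isWeightedHomogeneous_one _ _, fun p _ => by simp, by simp⟩
  mul_mem' := by
    rintro _ _ ⟨d, A, B, hA, hB, hP, rfl⟩ ⟨d', A', B', hA', hB', hP', rfl⟩
    refine ⟨d + d', A * A', B * B', hA.mul hA', hB.mul hB', fun p hp => ?_, ?_⟩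
    · rw [map_mul]
      exact mul_ne_zero (hP p hp) (hP' p hp)
    · rw [map_mul, map_mul, div_mul_div_comm]
  add_mem' := by
    rintro _ _ ⟨d, A, B, hA, hB, hP, rfl⟩ ⟨d', A', B', hA', hB', hP', rfl⟩
    by_cases h : H.dehomogenize B = 0
    · exact ⟨d', A', B', hA', hB', hP', by rw [h, div_zero, zero_add]⟩
    by_cases h' : H.dehomogenize B' = 0
    · exact ⟨d, A, B, hA, hB, hP, by rw [h', div_zero, add_zero]⟩
    refine ⟨d + d', A * B' + B * A', B * B', (hA.mul hB').add (hB.mul hA'), hB.mul hB',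
      fun p hp => ?_, ?_⟩
    · rw [map_mul]
      exact mul_ne_zero (hP p hp) (hP' p hp)
    · rw [map_mul, map_add, map_mul, map_mul, div_add_div _ _ h h']
  neg_mem' := by
    rintro _ ⟨d, A, B, hA, hB, hP, rfl⟩
    refine ⟨d, -A, B, ?_, hB, hP, by rw [map_neg, neg_div]⟩
    exact (MvPolynomial.weightedHomogeneousSubmodule K _ d).neg_mem hA

open Classical in
/-- The order `ord_P(f)` of a nonzero function `f` at `P`: the number of zeroes of `f` at `P`
(the length of `𝓞_P / (f)`) if `f` is regular at `P`, and the negative of the number of poles of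
`f` (zeroes of `f⁻¹`) otherwise. -/
def ordAt (P : H.Point) (f : H.FunctionField) : ℤ :=
  if h : f ∈ H.localRing P then ((Ring.ord (H.localRing P) ⟨f, h⟩).toNat : ℤ)
  else if h' : f⁻¹ ∈ H.localRing P then -((Ring.ord (H.localRing P) ⟨f⁻¹, h'⟩).toNat : ℤ)
  else 0

/-- Divisors: formal sums of points. -/
abbrev Divisor : Type _ := H.Point →₀ ℤ

/-- The degree `∑ n_P` of a divisor `∑ n_P (P)`. -/
def degree : H.Divisor →+ ℤ := Finsupp.liftAddHom fun _ => AddMonoidHom.id ℤ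

/-- The group of divisors of degree `0`. -/
def divisorsOfDegreeZero : AddSubgroup H.Divisor := H.degree.ker

/-- `D = div(f) = ∑ ord_P(f) (P)`. -/
def IsDivOf (D : H.Divisor) (f : H.FunctionField) : Prop := ∀ P, D P = H.ordAt P f

/-- The group of principal divisors: the group generated by the divisors `div(f)` of the nonzero
functions `f` (since `div(f g) = div(f) + div(g)`, these divisors already form a group when `K` is
algebraically closed of characteristic not `2`). -/
def principalDivisors : AddSubgroup H.Divisor :=
  AddSubgroup.closure {D | ∃ f : H.FunctionField, f ≠ 0 ∧ H.IsDivOf D f}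

/-- The group `Pic⁰(H)`, the group of points of the Jacobian of `H`: divisors of degree `0`
modulo principal divisors. -/
abbrev Jacobian : Type _ :=
  H.divisorsOfDegreeZero ⧸ H.principalDivisors.addSubgroupOf H.divisorsOfDegreeZero

/-- The divisor `(P) - (Q)` of degree `0`. -/
def pointDiff (P Q : H.Point) : H.divisorsOfDegreeZero :=
  ⟨Finsupp.single P 1 - Finsupp.single Q 1, by
    rw [divisorsOfDegreeZero, AddMonoidHom.mem_ker, map_sub]
    simp [degree]⟩

/-- The divisor class `[(P) - (Q)]`. -/
def pointDiffClass (P Q : H.Point) : H.Jacobian := QuotientAddGroup.mk (H.pointDiff P Q)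

/-- The `2`-torsion subgroup `J_H[2]`. -/
def jacobianTwoTorsion : AddSubgroup H.Jacobian := AddSubgroup.torsionBy H.Jacobian 2

/-- `π` is a partition of the set of Weierstrass points into four disjoint pairs. -/
structure IsPairPartition (π : Set (Set H.Point)) : Prop where
  ncard_eq : π.ncard = 4
  ncard_pair : ∀ B ∈ π, B.ncard = 2
  disjoint : π.PairwiseDisjoint id
  sUnion_eq : ⋃₀ π = H.weierstrassPoints

/-- The subgroup of `J_H` associated with a partition `π`, generated by the classes
`[(W') - (W'')]` for the pairs `{W', W''}` in `π`. -/
def partitionSubgroup (π : Set (Set H.Point)) : AddSubgroup H.Jacobian :=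
  AddSubgroup.closure {c | ∃ W' W'' : H.Point, {W', W''} ∈ π ∧ c = H.pointDiffClass W' W''}

theorem IsForm.map {G : MvPolynomial (Fin 3) K} {d : ℕ} (h : IsForm G d) (φ : K →+* K) :
    IsForm (MvPolynomial.map φ G) d := by
  intro m hm
  refine h fun h0 => hm ?_
  rw [MvPolynomial.coeff_map, h0, map_zero]

end Geometry

theorem ord_ringEquiv {R S : Type*} [CommRing R] [CommRing S] (e : R ≃+* S) (a : R) :
    Ring.ord S (e a) = Ring.ord R a := by
  have hI : Ideal.span {e a} = (Ideal.span {a}).map (e : R →+* S) := by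
    rw [Ideal.map_span, Set.image_singleton, RingHom.coe_coe]
  let g : (R ⧸ Ideal.span {a}) ≃+* (S ⧸ Ideal.span {e a}) := Ideal.quotientEquiv _ _ e hI
  let : RingHomInvPair (e : R →+* S) (e.symm : S →+* R) := RingHomInvPair.of_ringEquiv e
  let : RingHomInvPair (e.symm : S →+* R) (e : R →+* S) := RingHomInvPair.of_ringEquiv e.symm
  let g' : (R ⧸ Ideal.span {a}) ≃ₛₗ[(e : R →+* S)] (S ⧸ Ideal.span {e a}) :=
    { g with
      map_smul' := fun r m => by
        obtain ⟨m, rfl⟩ := Ideal.Quotient.mk_surjective m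
        exact map_mul g (Ideal.Quotient.mk _ r) (Ideal.Quotient.mk _ m) }
  apply WithBot.coe_injective
  rw [Ring.ord, Ring.ord, Module.coe_length, Module.coe_length]
  exact (Order.krullDim_eq_of_orderIso (Submodule.orderIsoMapComap g')).symm

section Galois

/-! ### The Galois action -/

variable {k : Type*} [Field k] [PerfectField k] (H : HyperellipticCurve3 k)
  (L : Type*) [Field L] [Algebra k L]

/-- The base change of the curve to an extension `L` of the (perfect) ground field. -/
def baseChange : HyperellipticCurve3 L where
  F := H.F.map (algebraMap k L)
  squarefree := ((PerfectField.separable_iff_squarefree.mpr H.squarefree).map).squarefree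
  natDegree_eq := by
    rw [natDegree_map]
    exact H.natDegree_eq

variable {L}

theorem map_baseChange_F (σ : Gal(L/k)) :
    (H.baseChange L).F.map (σ : L →+* L) = (H.baseChange L).F := by
  simp only [baseChange, Polynomial.map_map]
  congr 1
  ext a
  simp

theorem map_baseChange_form (σ : Gal(L/k)) :
    MvPolynomial.map (σ : L →+* L) (H.baseChange L).form = (H.baseChange L).form := by
  rw [form, ← homogenize_map, map_baseChange_F]

theorem eval_form_galois (σ : Gal(L/k)) (a b : L) :
    MvPolynomial.eval ![σ a, σ b] (H.baseChange L).form =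
      σ (MvPolynomial.eval ![a, b] (H.baseChange L).form) := by
  have h := MvPolynomial.map_eval (σ : L →+* L) ![a, b] (H.baseChange L).form
  rw [map_baseChange_form] at h
  have h' : (⇑(σ : L →+* L) ∘ ![a, b]) = ![σ a, σ b] := by
    ext i; fin_cases i <;> rfl
  rw [h'] at h
  exact h.symm

/-- Galois acts on triples coordinatewise. -/
def galTriple (σ : Gal(L/k)) (p : (H.baseChange L).Triple) : (H.baseChange L).Triple :=
  ⟨fun i => σ (p.1 i), fun h => p.2.1 (funext fun i => by simpa using congrFun h i), by
    rw [H.eval_form_galois, ← p.2.2, map_pow]⟩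

/-- The action of the Galois group on the points of the curve. -/
def galPoint (σ : Gal(L/k)) : (H.baseChange L).Point → (H.baseChange L).Point :=
  Quotient.map (H.galTriple σ) (by
    rintro p q ⟨c, h⟩
    refine ⟨Units.map (σ : L →* L) c, ?_⟩
    ext i
    have := congrFun h i
    fin_cases i <;> simp [galTriple] at this ⊢ <;> simp [this])


/-- The action of the Galois group on the divisors of the curve. -/
def galDivisor (σ : Gal(L/k)) : (H.baseChange L).Divisor →+ (H.baseChange L).Divisor :=
  Finsupp.mapDomain.addMonoidHom (H.galPoint σ)

theorem galTriple_symm_galTriple (σ : Gal(L/k)) (p : (H.baseChange L).Triple) :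
    H.galTriple σ.symm (H.galTriple σ p) = p :=
  Subtype.ext (funext fun i => σ.symm_apply_apply (p.1 i))

theorem galPoint_symm_galPoint (σ : Gal(L/k)) (P : (H.baseChange L).Point) :
    H.galPoint σ.symm (H.galPoint σ P) = P := by
  induction P using Quotient.inductionOn with
  | h p => exact congrArg (Quotient.mk _) (H.galTriple_symm_galTriple σ p)

theorem map_equation (σ : Gal(L/k)) :
    (H.baseChange L).equation.map (mapEquiv (σ : L ≃+* L)).toRingHom =
      (H.baseChange L).equation := by
  have h := H.map_baseChange_F σ
  simp only [equation, Polynomial.map_sub, Polynomial.map_pow, map_X, map_C]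
  congr 2

/-- The action of the Galois group on the coordinate ring, fixing `x` and `y`. -/
def galCoordinateRing (σ : Gal(L/k)) :
    (H.baseChange L).CoordinateRing ≃+* (H.baseChange L).CoordinateRing :=
  AdjoinRoot.mapRingEquiv (mapEquiv (σ : L ≃+* L)) _ _ (by
    refine Associated.of_eq ?_
    exact H.map_equation σ)

/-- The action of the Galois group on the function field, fixing `x` and `y`. -/
def galFunction (σ : Gal(L/k)) :
    (H.baseChange L).FunctionField ≃+* (H.baseChange L).FunctionField :=
  IsFractionRing.ringEquivOfRingEquiv (H.galCoordinateRing σ)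

theorem galFunction_symm_apply (σ : Gal(L/k)) (f : (H.baseChange L).FunctionField) :
    H.galFunction σ.symm (H.galFunction σ f) = f := by
  have h : (H.galFunction σ).symm (H.galFunction σ f) = H.galFunction σ.symm (H.galFunction σ f) := by
    simp only [galFunction, galCoordinateRing, IsFractionRing.ringEquivOfRingEquiv_symm,
      AdjoinRoot.symm_mapRingEquiv]
    rfl
  rw [← h, RingEquiv.symm_apply_apply]

theorem galFunction_dehomogenize (σ : Gal(L/k)) (G : MvPolynomial (Fin 3) L) :
    H.galFunction σ ((H.baseChange L).dehomogenize G) =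
      (H.baseChange L).dehomogenize (MvPolynomial.map (σ : L →+* L) G) := by
  have key : ((H.galFunction σ : _ →+* (H.baseChange L).FunctionField)).comp
      (H.baseChange L).dehomogenize =
      (H.baseChange L).dehomogenize.comp (MvPolynomial.map (σ : L →+* L)) := by
    refine MvPolynomial.ringHom_ext (fun a => ?_) fun i => ?_
    · simp only [RingHom.comp_apply, dehomogenize, MvPolynomial.coe_eval₂Hom,
        MvPolynomial.eval₂_C, MvPolynomial.map_C, const]
      rw [RingHom.coe_coe, galFunction, IsFractionRing.ringEquivOfRingEquiv_algebraMap,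
        galCoordinateRing, AdjoinRoot.coe_mapRingEquiv, AdjoinRoot.map_of]
      congr 2
      exact Polynomial.map_C _
    · have hx : H.galFunction σ (H.baseChange L).x = (H.baseChange L).x := by
        rw [galFunction, x, IsFractionRing.ringEquivOfRingEquiv_algebraMap,
          galCoordinateRing, AdjoinRoot.coe_mapRingEquiv, AdjoinRoot.map_of]
        congr 2
        exact Polynomial.map_X _
      have hy : H.galFunction σ (H.baseChange L).y = (H.baseChange L).y := by
        rw [galFunction, y, IsFractionRing.ringEquivOfRingEquiv_algebraMap,
          galCoordinateRing, AdjoinRoot.coe_mapRingEquiv, AdjoinRoot.map_root]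
      fin_cases i <;> simp [dehomogenize, hx, hy]
  exact RingHom.congr_fun key G

theorem galFunction_mem_localRing (σ : Gal(L/k)) {P : (H.baseChange L).Point}
    {f : (H.baseChange L).FunctionField} (hf : f ∈ (H.baseChange L).localRing P) :
    H.galFunction σ f ∈ (H.baseChange L).localRing (H.galPoint σ P) := by
  obtain ⟨d, A, B, hA, hB, hP, rfl⟩ := hf
  refine ⟨d, _, _, hA.map _, hB.map _, fun p hp h0 => ?_, by
    rw [map_div₀, galFunction_dehomogenize, galFunction_dehomogenize]⟩
  refine hP (H.galTriple σ.symm p) ?_ ?_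
  · rw [← H.galPoint_symm_galPoint σ P, ← hp]
    rfl
  · have h := MvPolynomial.map_eval (σ : L →+* L) (H.galTriple σ.symm p).1 B
    have h' : (⇑(σ : L →+* L) ∘ (H.galTriple σ.symm p).1) = p.1 :=
      funext fun i => σ.apply_symm_apply (p.1 i)
    rw [h', h0] at h
    exact (map_eq_zero _).mp h

theorem galFunction_mem_localRing_iff (σ : Gal(L/k)) {P : (H.baseChange L).Point}
    {f : (H.baseChange L).FunctionField} :
    H.galFunction σ f ∈ (H.baseChange L).localRing (H.galPoint σ P) ↔
      f ∈ (H.baseChange L).localRing P := by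
  refine ⟨fun h => ?_, H.galFunction_mem_localRing σ⟩
  have h' := H.galFunction_mem_localRing σ.symm h
  rwa [galFunction_symm_apply, galPoint_symm_galPoint] at h'

theorem ordAt_galPoint (σ : Gal(L/k)) (P : (H.baseChange L).Point)
    (f : (H.baseChange L).FunctionField) :
    (H.baseChange L).ordAt (H.galPoint σ P) (H.galFunction σ f) = (H.baseChange L).ordAt P f := by
  let e : (H.baseChange L).localRing P ≃+* (H.baseChange L).localRing (H.galPoint σ P) :=
    (H.galFunction σ).restrict _ _ fun _ => (H.galFunction_mem_localRing_iff σ).symm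
  have h1 : ∀ g (h : g ∈ (H.baseChange L).localRing P), e ⟨g, h⟩ =
    ⟨H.galFunction σ g, H.galFunction_mem_localRing σ h⟩ := fun g h => rfl
  by_cases h : f ∈ (H.baseChange L).localRing P
  · rw [ordAt, ordAt, dif_pos h, dif_pos (H.galFunction_mem_localRing σ h), ← h1,
      ord_ringEquiv]
  · have hσ : H.galFunction σ f ∉ (H.baseChange L).localRing (H.galPoint σ P) :=
      fun h' => h ((H.galFunction_mem_localRing_iff σ).mp h')
    rw [ordAt, ordAt, dif_neg h, dif_neg hσ]
    by_cases hi : f⁻¹ ∈ (H.baseChange L).localRing P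
    · have hi' := H.galFunction_mem_localRing σ hi
      have h2 := h1 _ hi
      simp only [map_inv₀] at hi' h2
      rw [dif_pos hi, dif_pos hi', ← h2, ord_ringEquiv]
    · rw [dif_neg hi, dif_neg]
      rw [← map_inv₀]
      exact fun h' => hi ((H.galFunction_mem_localRing_iff σ).mp h')

theorem galDivisor_mem_principalDivisors (σ : Gal(L/k)) {D : (H.baseChange L).Divisor}
    (hD : D ∈ (H.baseChange L).principalDivisors) :
    H.galDivisor σ D ∈ (H.baseChange L).principalDivisors := by
  suffices h : (H.baseChange L).principalDivisors ≤
      (H.baseChange L).principalDivisors.comap (H.galDivisor σ) from h hD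
  rw [principalDivisors, AddSubgroup.closure_le]
  rintro E ⟨f, hf, hE⟩
  refine AddSubgroup.subset_closure ⟨H.galFunction σ f, by simpa using hf, fun P => ?_⟩
  have hinj : Function.Injective (H.galPoint σ) :=
    Function.LeftInverse.injective (H.galPoint_symm_galPoint σ)
  have hP : H.galPoint σ (H.galPoint σ.symm P) = P := H.galPoint_symm_galPoint σ.symm P
  rw [← hP, ordAt_galPoint, ← hE]
  exact Finsupp.mapDomain_apply hinj E _

theorem degree_galDivisor (σ : Gal(L/k)) (D : (H.baseChange L).Divisor) :
    (H.baseChange L).degree (H.galDivisor σ D) = (H.baseChange L).degree D := by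
  induction D using Finsupp.induction_linear with
  | zero => simp
  | add D E hD hE => rw [map_add, map_add, map_add, hD, hE]
  | single P n => simp [galDivisor, degree]

/-- The action of the Galois group on the divisors of degree `0`. -/
def galDivisorZero (σ : Gal(L/k)) :
    (H.baseChange L).divisorsOfDegreeZero →+ (H.baseChange L).divisorsOfDegreeZero :=
  ((H.galDivisor σ).comp (H.baseChange L).divisorsOfDegreeZero.subtype).codRestrict _ fun D => by
    have h : (H.baseChange L).degree D = 0 := D.2
    exact (H.degree_galDivisor σ D).trans h

/-- The action of the Galois group on the Jacobian: `[D]` is sent to `[σ(D)]`. -/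
def galJacobian (σ : Gal(L/k)) : (H.baseChange L).Jacobian →+ (H.baseChange L).Jacobian :=
  QuotientAddGroup.map _ _ (H.galDivisorZero σ) fun _ hD =>
    H.galDivisor_mem_principalDivisors σ hD

end Galois

end

end HyperellipticCurve3

/-!
The proof computes with divisors of functions in two affine charts of the curve.

In the chart `Y² = G(X)` every function is `(a(X) + b(X) Y) / c(X)`, and a function `a + b Y` whose
value at a point is not zero is a unit of the local ring there. From this a uniformizer is
found by hand: `X - x₀` at a point `(x₀, y₀)` with `y₀ ≠ 0` (`IsChartAt.isUniformizer_map`), and `Y`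
at a Weierstrass point (`IsChartAt.isUniformizer_root`), where `X - x₀` is `Y²` times a unit. The
order defined by the length of `𝓞_P / (f)` is therefore the exponent of the uniformizer
(`ordAt_zpow_mul`), and orders are additive. The charts with coordinates `x, y` and
`1 / x, y / x⁴` cover the curve (`isChartAt_affinePoint`, `isChartAt_infinitePoint`). To treat
affine and infinite points alike, orders of functions are written as orders of forms in `u, v, w`
plus a multiple of `poleOrd`, which is minus the order of the coordinate `v`.

The form `w` has divisor `∑ W`, the sum of the Weierstrass points (`ordAt_y`), and each Weierstrass
point `W` has a linear form `l_W` in `u, v` with divisor `2 W` (`exists_ordAt_ofX_eq`). The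
functions `l_{W'} / l_{W''}` and `w / ∏ l_{W''}` prove `2 e_i = 0` and `e_1 + e_2 + e_3 + e_4 = 0`.

There are no further relations (`sum_subset_pointDiffClass_ne_zero`). Modulo `2`, another one would
be the vanishing of `∑_{i ∈ I} e_i` with `I` nonempty and proper. If this sum is the divisor of `f`,
then `f ∏_{i ∈ I} l_{W''_i}` has no affine poles and poles at infinity no worse than those of a form
of degree `|I| ≤ 3`. Such a function is a polynomial in `x` alone, because `y = w / v⁴` has too
large a pole (`exists_eq_ofX_of_mul_poleOrd_le`). Polynomials in `x` have even order at
Weierstrass points, whereas this function has odd order at `W'_i` for `i ∈ I`.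
-/

/-! ### Uniformizers and orders of vanishing -/

/-- An element `t` of a subring `R` of a field is a uniformizer if it is not a unit of `R` and every
nonzero element of the field is a power of `t` times a unit of `R`. -/
structure IsUniformizer {Φ : Type*} [Field Φ] (R : Subring Φ) (t : Φ) : Prop where
  mem : t ∈ R
  inv_notMem : t⁻¹ ∉ R
  exists_eq_zpow_mul : ∀ f : Φ, f ≠ 0 → ∃ (n : ℤ) (u : Φ), u ∈ R ∧ u⁻¹ ∈ R ∧ f = t ^ n * u

namespace IsUniformizer

variable {Φ : Type*} [Field Φ] {R : Subring Φ} {t u : Φ}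

theorem ne_zero (h : IsUniformizer R t) : t ≠ 0 := by
  rintro rfl
  exact h.inv_notMem (by simp)

theorem zpow_mul_mem_iff (h : IsUniformizer R t) (hu : u ∈ R) (hu' : u⁻¹ ∈ R) (hu0 : u ≠ 0)
    (n : ℤ) : t ^ n * u ∈ R ↔ 0 ≤ n := by
  refine ⟨fun hm => ?_, fun hn => ?_⟩
  · by_contra! hn
    obtain ⟨m, rfl⟩ : ∃ m : ℕ, n = -(m : ℤ) - 1 := ⟨(-n - 1).toNat, by omega⟩
    refine h.inv_notMem ?_
    have h1 : t⁻¹ = t ^ m * (t ^ (-(m : ℤ) - 1) * u) * u⁻¹ := by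
      have := h.ne_zero
      rw [zpow_sub₀ this, zpow_neg, zpow_natCast, zpow_one]
      field_simp
    rw [h1]
    exact R.mul_mem (R.mul_mem (R.pow_mem h.mem m) hm) hu'
  · lift n to ℕ using hn
    rw [zpow_natCast]
    exact R.mul_mem (R.pow_mem h.mem n) hu

theorem isMaximal_span (h : IsUniformizer R t) :
    (Ideal.span {(⟨t, h.mem⟩ : R)}).IsMaximal := by
  rw [Ideal.isMaximal_iff]
  refine ⟨fun h1 => ?_, fun J a hJ ha haJ => ?_⟩
  · obtain ⟨c, hc⟩ := Ideal.mem_span_singleton'.mp h1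
    have hc' : (c : Φ) * t = 1 := congrArg Subtype.val hc
    exact h.inv_notMem (eq_inv_of_mul_eq_one_left hc' ▸ c.2)
  · have ha0 : (a : Φ) ≠ 0 := fun h0 => ha (by
      rw [show a = 0 from Subtype.ext h0]
      exact Ideal.zero_mem _)
    obtain ⟨n, u, hu, hu', hau⟩ := h.exists_eq_zpow_mul a ha0
    have hu0 : u ≠ 0 := by rintro rfl; exact ha0 (by simpa using hau)
    have hn : 0 ≤ n := (h.zpow_mul_mem_iff hu hu' hu0 n).mp (hau ▸ a.2)
    lift n to ℕ using hn
    rcases n with _ | n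
    · have : (1 : R) = ⟨u⁻¹, hu'⟩ * a := Subtype.ext (by simp [hau, hu0])
      rw [this]
      exact J.mul_mem_left _ haJ
    · refine absurd (Ideal.mem_span_singleton'.mpr
        ⟨⟨t ^ n * u, R.mul_mem (R.pow_mem h.mem n) hu⟩, Subtype.ext ?_⟩) ha
      simp only [Subring.coe_mul, hau, zpow_natCast]
      ring

/-- The order of vanishing in the sense of lengths is the exponent of the uniformizer. -/
theorem ord_pow_mul (h : IsUniformizer R t) (hu : u ∈ R) (hu' : u⁻¹ ∈ R) (hu0 : u ≠ 0) (n : ℕ)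
    (hm : t ^ n * u ∈ R) : Ring.ord R ⟨t ^ n * u, hm⟩ = n := by
  have hunit : IsUnit (⟨u, hu⟩ : R) :=
    IsUnit.of_mul_eq_one ⟨u⁻¹, hu'⟩ (Subtype.ext (mul_inv_cancel₀ hu0))
  have ht : (⟨t, h.mem⟩ : R) ∈ nonZeroDivisors R :=
    mem_nonZeroDivisors_of_ne_zero fun h0 => h.ne_zero (congrArg Subtype.val h0)
  have h1 : Ring.ord R ⟨t, h.mem⟩ = 1 := by
    rw [Ring.ord, Module.length_eq_one_iff, isSimpleModule_iff_isCoatom]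
    exact h.isMaximal_span.out
  have h2 : (⟨t ^ n * u, hm⟩ : R) = ⟨t, h.mem⟩ ^ n * ⟨u, hu⟩ := rfl
  rw [h2, Ring.ord_mul_of_isUnit_right hunit, Ring.ord_pow ht, h1]
  simp

end IsUniformizer

theorem Polynomial.exists_eq_X_sub_C_pow_mul {K : Type*} [Field K] {a : K[X]} (ha : a ≠ 0)
    (x₀ : K) : ∃ (n : ℕ) (b : K[X]), a = (X - C x₀) ^ n * b ∧ b.eval x₀ ≠ 0 := by
  obtain ⟨b, hb, hb'⟩ := exists_eq_pow_rootMultiplicity_mul_and_not_dvd a ha x₀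
  exact ⟨_, b, hb, fun h0 => hb' (dvd_iff_isRoot.mpr h0)⟩

/-! ### Local charts of a double cover of the line -/

/-- The subring `R` of the field `Φ` is the local ring at the point `(x₀, y₀)` of the affine curve
`Y² = G(X)`, where `φ` is the map `a ↦ a(X)` to the function field `Φ`, and `x₀` is a simple root of
`G` if `y₀ = 0`, so that the curve is smooth at the point in characteristic not `2`. -/
structure IsChartAt {K Φ : Type*} [Field K] [Field Φ] (φ : K[X] →+* Φ) (Y : Φ) (G : K[X])
    (R : Subring Φ) (x₀ y₀ : K) : Prop where
  sq_eq : Y ^ 2 = φ G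
  eq_zero : ∀ a b, φ a + φ b * Y = 0 → a = 0 ∧ b = 0
  exists_eq_div : ∀ f : Φ, ∃ a b c, c ≠ 0 ∧ f = (φ a + φ b * Y) / φ c
  eval_eq : y₀ ^ 2 = G.eval x₀
  simple : y₀ = 0 → ∃ G₁, G = (X - C x₀) * G₁ ∧ G₁.eval x₀ ≠ 0
  mem_iff : ∀ f, f ∈ R ↔ ∃ a b c d : K[X], c.eval x₀ + d.eval x₀ * y₀ ≠ 0 ∧
    f = (φ a + φ b * Y) / (φ c + φ d * Y)

namespace IsChartAt

variable {K Φ : Type*} [Field K] [Field Φ] {φ : K[X] →+* Φ} {Y : Φ} {G : K[X]}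
  {R : Subring Φ} {x₀ y₀ : K}

theorem map_ne_zero (h : IsChartAt φ Y G R x₀ y₀) {a : K[X]} (ha : a ≠ 0) : φ a ≠ 0 :=
  fun h0 => ha (h.eq_zero a 0 (by simp [h0])).1

theorem add_mem (h : IsChartAt φ Y G R x₀ y₀) (a b : K[X]) : φ a + φ b * Y ∈ R :=
  (h.mem_iff _).mpr ⟨a, b, 1, 0, by simp, by simp⟩

theorem map_mem (h : IsChartAt φ Y G R x₀ y₀) (a : K[X]) : φ a ∈ R := by
  simpa using h.add_mem a 0

theorem inv_add_mem (h : IsChartAt φ Y G R x₀ y₀) {a b : K[X]}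
    (hab : a.eval x₀ + b.eval x₀ * y₀ ≠ 0) : (φ a + φ b * Y)⁻¹ ∈ R :=
  (h.mem_iff _).mpr ⟨1, 0, a, b, hab, by simp⟩

theorem inv_map_mem (h : IsChartAt φ Y G R x₀ y₀) {a : K[X]} (ha : a.eval x₀ ≠ 0) :
    (φ a)⁻¹ ∈ R := by
  simpa using h.inv_add_mem (a := a) (b := 0) (by simpa using ha)

theorem add_ne_zero (h : IsChartAt φ Y G R x₀ y₀) {a b : K[X]}
    (hab : a.eval x₀ + b.eval x₀ * y₀ ≠ 0) : φ a + φ b * Y ≠ 0 := fun h0 => by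
  obtain ⟨rfl, rfl⟩ := h.eq_zero a b h0
  simp at hab

/-- If `(a + b Y) / e` is regular at the point and `e` vanishes at `x₀`, then `a + b Y` vanishes at
the point. -/
theorem eval_eq_zero (h : IsChartAt φ Y G R x₀ y₀) {a b e : K[X]} (he0 : e ≠ 0)
    (he : e.eval x₀ = 0)
    (hm : (φ a + φ b * Y) / φ e ∈ R) : a.eval x₀ + b.eval x₀ * y₀ = 0 := by
  obtain ⟨a', b', c, d, hcd, heq⟩ := (h.mem_iff _).mp hm
  rw [div_eq_div_iff (h.map_ne_zero he0) (h.add_ne_zero hcd)] at heq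
  have h0 := h.eq_zero (a * c + b * d * G - a' * e) (a * d + b * c - b' * e) (by
    simp only [map_sub, map_add, map_mul, ← h.sq_eq]
    linear_combination heq)
  have h1 := congrArg (Polynomial.eval x₀) h0.1
  have h2 := congrArg (Polynomial.eval x₀) h0.2
  simp only [eval_sub, eval_add, eval_mul, eval_zero, ← h.eval_eq, he] at h1 h2
  refine (mul_eq_zero.mp ?_).resolve_right hcd
  linear_combination h1 + y₀ * h2

/-- If `(a + b Y) / (X - x₀)` is regular at both points `(x₀, ± y₀)` above `x₀`, then `X - x₀`
divides both `a` and `b`. -/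
theorem eval_eq_zero_and (h2 : (2 : K) ≠ 0) {R' : Subring Φ} (h : IsChartAt φ Y G R x₀ y₀)
    (h' : IsChartAt φ Y G R' x₀ (-y₀)) {a b : K[X]}
    (hm : (φ a + φ b * Y) / φ (X - C x₀) ∈ R) (hm' : (φ a + φ b * Y) / φ (X - C x₀) ∈ R') :
    a.eval x₀ = 0 ∧ b.eval x₀ = 0 := by
  have hX : (X - C x₀ : K[X]) ≠ 0 := X_sub_C_ne_zero x₀
  have e1 := h.eval_eq_zero hX (by simp) hm
  have e2 := h'.eval_eq_zero hX (by simp) hm'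
  have ha : a.eval x₀ = 0 := by
    refine (mul_eq_zero.mp ?_).resolve_left h2
    linear_combination e1 + e2
  refine ⟨ha, ?_⟩
  by_cases hy : y₀ = 0
  · -- Here `a = (X - x₀) a₁`, so that already `b Y / (X - x₀) = b G₁ / Y` is regular.
    obtain ⟨a₁, rfl⟩ := dvd_iff_isRoot.mpr ha
    obtain ⟨a', b', c, d, hcd, heq⟩ := (h.mem_iff _).mp hm
    rw [div_eq_div_iff (h.map_ne_zero hX) (h.add_ne_zero hcd)] at heq
    have h0 := h.eq_zero ((X - C x₀) * a₁ * c + b * d * G - a' * (X - C x₀))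
      ((X - C x₀) * a₁ * d + b * c - b' * (X - C x₀)) (by
      simp only [map_sub, map_add, map_mul, ← h.sq_eq] at heq ⊢
      linear_combination heq)
    have h3 := congrArg (Polynomial.eval x₀) h0.2
    simp only [eval_sub, eval_add, eval_mul, eval_zero, eval_X, eval_C] at h3
    rw [hy, mul_zero, add_zero] at hcd
    refine (mul_eq_zero.mp ?_).resolve_right hcd
    linear_combination h3
  · refine (mul_eq_zero.mp ?_).resolve_right hy
    linear_combination e1 - ha

/-- To find a uniformizer it is enough to factor the functions `a + b Y`. -/
theorem isUniformizer_of (h : IsChartAt φ Y G R x₀ y₀) {t : Φ} (ht : t ∈ R) (ht' : t⁻¹ ∉ R)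
    (H : ∀ a b : K[X], φ a + φ b * Y ≠ 0 →
      ∃ (n : ℤ) (u : Φ), u ∈ R ∧ u⁻¹ ∈ R ∧ φ a + φ b * Y = t ^ n * u) : IsUniformizer R t := by
  have ht0 : t ≠ 0 := by rintro rfl; exact ht' (by simp)
  refine ⟨ht, ht', fun f hf => ?_⟩
  obtain ⟨a, b, c, hc, rfl⟩ := h.exists_eq_div f
  obtain ⟨n, u, hu, hu', hn⟩ := H a b (div_ne_zero_iff.mp hf).1
  obtain ⟨m, v, hv, hv', hm⟩ := H c 0 (by simpa using h.map_ne_zero hc)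
  rw [map_zero, zero_mul, add_zero] at hm
  refine ⟨n - m, u * v⁻¹, R.mul_mem hu hv', ?_, ?_⟩
  · rw [mul_inv, inv_inv]
    exact R.mul_mem hu' hv
  · rw [hn, hm, zpow_sub₀ ht0]
    field_simp

/-- At a point with `y₀ ≠ 0` the function `X - x₀` is a uniformizer. -/
theorem isUniformizer_map (h2 : (2 : K) ≠ 0) (h : IsChartAt φ Y G R x₀ y₀) (hy : y₀ ≠ 0) :
    IsUniformizer R (φ (X - C x₀)) := by
  have hX : (X - C x₀ : K[X]) ≠ 0 := X_sub_C_ne_zero x₀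
  refine h.isUniformizer_of (h.map_mem _) (fun hm => ?_) ?_
  · simpa using h.eval_eq_zero (a := 1) (b := 0) hX (by simp) (by simpa using hm)
  intro a b hab
  have hab0 : a ≠ 0 ∨ b ≠ 0 := by
    by_contra! h0
    exact hab (by simp [h0.1, h0.2])
  obtain ⟨d, a₁, b₁, rfl, rfl, hab₁⟩ : ∃ d a₁ b₁, a = d * a₁ ∧ b = d * b₁ ∧ IsCoprime a₁ b₁ := by
    classical
    let := EuclideanDomain.gcdMonoid K[X]
    obtain ⟨a₁, b₁, ha, hb, hu⟩ := extract_gcd a b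
    exact ⟨_, a₁, b₁, ha, hb, (gcd_isUnit_iff _ _).mp hu⟩
  have hd : d ≠ 0 := by rintro rfl; simp at hab0
  obtain ⟨r, d₁, rfl, hd₁⟩ := exists_eq_X_sub_C_pow_mul hd x₀
  have hu := h.map_mem d₁
  have hu' := h.inv_map_mem hd₁
  have hu0 : φ d₁ ≠ 0 := fun h0 => hab (by simp [h0])
  -- Coprime polynomials have no common root.
  have hnot : ¬ (a₁.eval x₀ = 0 ∧ b₁.eval x₀ = 0) := by
    rintro ⟨h1, h2⟩
    obtain ⟨p, q, hpq⟩ := hab₁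
    simpa [h1, h2] using congrArg (Polynomial.eval x₀) hpq
  by_cases hv : a₁.eval x₀ + b₁.eval x₀ * y₀ = 0
  · -- The conjugate `a₁ - b₁ Y` is a unit, and the norm is a polynomial in `X`.
    have hc : a₁.eval x₀ + (-b₁).eval x₀ * y₀ ≠ 0 := by
      intro hc
      rw [eval_neg] at hc
      have ha : a₁.eval x₀ = 0 := by
        refine (mul_eq_zero.mp ?_).resolve_left h2
        linear_combination hv + hc
      refine hnot ⟨ha, (mul_eq_zero.mp ?_).resolve_right hy⟩
      linear_combination hv - ha
    have hconj := h.add_ne_zero hc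
    have hnorm : (φ a₁ + φ b₁ * Y) * (φ a₁ + φ (-b₁) * Y) = φ (a₁ ^ 2 - b₁ ^ 2 * G) := by
      simp only [map_sub, map_mul, map_pow, map_neg, ← h.sq_eq]
      ring
    have hN : a₁ ^ 2 - b₁ ^ 2 * G ≠ 0 := by
      intro h0
      rw [h0, map_zero] at hnorm
      refine (mul_eq_zero.mp hnorm).elim (fun h1 => hab ?_) hconj
      simp only [map_mul]
      linear_combination (φ ((X - C x₀) ^ r) * φ d₁) * h1
    obtain ⟨s, n₁, hs, hn₁⟩ := exists_eq_X_sub_C_pow_mul hN x₀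
    refine ⟨r + s, φ d₁ * φ n₁ * (φ a₁ + φ (-b₁) * Y)⁻¹,
      R.mul_mem (R.mul_mem hu (h.map_mem _)) (h.inv_add_mem hc), ?_, ?_⟩
    · rw [mul_inv, mul_inv, inv_inv]
      exact R.mul_mem (R.mul_mem hu' (h.inv_map_mem hn₁)) (h.add_mem _ _)
    · rw [hs] at hnorm
      rw [zpow_add₀ (h.map_ne_zero hX), zpow_natCast, zpow_natCast, ← div_eq_mul_inv,
        ← mul_div_assoc, eq_div_iff hconj]
      simp only [map_mul, map_pow] at hnorm ⊢
      linear_combination (φ (X - C x₀) ^ r * φ d₁) * hnorm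
  · refine ⟨r, φ d₁ * (φ a₁ + φ b₁ * Y), R.mul_mem hu (h.add_mem _ _), ?_, ?_⟩
    · rw [mul_inv]
      exact R.mul_mem hu' (h.inv_add_mem hv)
    · simp only [map_mul, map_pow, zpow_natCast]
      ring

/-- At a point with `y₀ = 0`, adding a multiple of `Y` to `1` gives a unit. -/
theorem inv_one_add_mul_mem (h : IsChartAt φ Y G R x₀ y₀) (hy : y₀ = 0) {γ : Φ} (hγ : γ ∈ R) :
    (1 + Y * γ)⁻¹ ∈ R := by
  obtain ⟨a, b, c, d, hcd, rfl⟩ := (h.mem_iff _).mp hγ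
  have hG : G.eval x₀ = 0 := by rw [← h.eval_eq, hy]; simp
  have hne := h.add_ne_zero hcd
  have h1 : (1 + Y * ((φ a + φ b * Y) / (φ c + φ d * Y)))⁻¹ =
      (φ c + φ d * Y) * (φ (c + b * G) + φ (d + a) * Y)⁻¹ := by
    rw [← inv_inv (φ c + φ d * Y), ← mul_inv, inv_inv, inv_inj, eq_inv_mul_iff_mul_eq₀ hne]
    simp only [map_add, map_mul, ← h.sq_eq]
    field_simp
    ring
  rw [h1]
  refine R.mul_mem (h.add_mem _ _) (h.inv_add_mem ?_)
  simpa [hG, hy] using hcd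

/-- At a point with `y₀ = 0` a function of `X` is an even power of `Y` times a unit. -/
theorem exists_eq_even_pow (h : IsChartAt φ Y G R x₀ y₀) (hy : y₀ = 0) {a : K[X]} (ha : a ≠ 0) :
    ∃ (r : ℕ) (u : Φ), u ∈ R ∧ u⁻¹ ∈ R ∧ φ a = Y ^ (2 * r) * u := by
  obtain ⟨G₁, hG, hG₁⟩ := h.simple hy
  obtain ⟨r, a', rfl, ha'⟩ := exists_eq_X_sub_C_pow_mul ha x₀
  refine ⟨r, (φ G₁)⁻¹ ^ r * φ a', R.mul_mem (R.pow_mem (h.inv_map_mem hG₁) _) (h.map_mem _), ?_, ?_⟩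
  · rw [mul_inv, inv_pow, inv_inv]
    exact R.mul_mem (R.pow_mem (h.map_mem _) _) (h.inv_map_mem ha')
  · have hG0 : φ G₁ ≠ 0 := h.map_ne_zero fun h0 => hG₁ (by simp [h0])
    rw [pow_mul, h.sq_eq, hG, map_mul, map_mul, map_pow, mul_pow, inv_pow]
    field_simp

/-- At a point with `y₀ = 0` the function `Y` is a uniformizer. -/
theorem isUniformizer_root (h2 : (2 : K) ≠ 0) (h : IsChartAt φ Y G R x₀ y₀) (hy : y₀ = 0) :
    IsUniformizer R Y := by
  have hYm : Y ∈ R := by simpa using h.add_mem 0 1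
  have hY0 : Y ≠ 0 := by
    rintro rfl
    simpa using h.eq_zero 0 1
  obtain ⟨G₁, hG, hG₁⟩ := h.simple hy
  refine h.isUniformizer_of hYm (fun hm => ?_) fun a b hab => ?_
  · -- If `Y⁻¹` is regular, so is `G₁ / Y = Y / (X - x₀)`.
    have h0 : G₁ ≠ 0 := by rintro rfl; simp at hG₁
    have h1 : (φ 0 + φ 1 * Y) / φ (X - C x₀) = Y⁻¹ * φ G₁ := by
      rw [div_eq_iff (h.map_ne_zero (X_sub_C_ne_zero x₀)), mul_assoc, ← map_mul, mul_comm G₁, ← hG,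
        ← h.sq_eq]
      simp
      field_simp
    have h3 : (φ 0 + φ 1 * Y) / φ (X - C x₀) ∈ R := h1 ▸ R.mul_mem hm (h.map_mem _)
    simpa using (h.eval_eq_zero_and h2 (by rwa [hy, neg_zero, ← hy]) h3 h3).2
  by_cases ha : a = 0
  · obtain ⟨s, v, hv, hv', hb⟩ := h.exists_eq_even_pow hy (a := b) (by rintro rfl; simp [ha] at hab)
    exact ⟨2 * s + 1, v, hv, hv', by rw [ha, hb]; norm_cast; simp; ring⟩
  obtain ⟨r, u, hu, hu', hau⟩ := h.exists_eq_even_pow hy ha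
  have hu0 : u ≠ 0 := by
    rintro rfl
    exact h.map_ne_zero ha (by simp [hau])
  by_cases hb : b = 0
  · exact ⟨2 * r, u, hu, hu', by rw [hb, hau]; norm_cast; simp⟩
  obtain ⟨s, v, hv, hv', hbv⟩ := h.exists_eq_even_pow hy hb
  have hv0 : v ≠ 0 := by
    rintro rfl
    exact h.map_ne_zero hb (by simp [hbv])
  -- The exponents `2 r` and `2 s + 1` of the two terms differ: factor out the smaller one.
  rcases lt_or_ge s r with hrs | hrs
  · obtain ⟨m, rfl⟩ := Nat.exists_eq_add_of_lt hrs
    have hγ : Y ^ (2 * m) * u * v⁻¹ ∈ R := R.mul_mem (R.mul_mem (R.pow_mem hYm _) hu) hv'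
    refine ⟨2 * s + 1, v * (1 + Y * (Y ^ (2 * m) * u * v⁻¹)),
      R.mul_mem hv (R.add_mem R.one_mem (R.mul_mem hYm hγ)), ?_, ?_⟩
    · rw [mul_inv]
      exact R.mul_mem hv' (h.inv_one_add_mul_mem hy hγ)
    · rw [hau, hbv]
      norm_cast
      field_simp
      ring
  · obtain ⟨m, rfl⟩ := Nat.exists_eq_add_of_le hrs
    have hγ : Y ^ (2 * m) * v * u⁻¹ ∈ R := R.mul_mem (R.mul_mem (R.pow_mem hYm _) hv) hu'
    refine ⟨2 * r, u * (1 + Y * (Y ^ (2 * m) * v * u⁻¹)),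
      R.mul_mem hu (R.add_mem R.one_mem (R.mul_mem hYm hγ)), ?_, ?_⟩
    · rw [mul_inv]
      exact R.mul_mem hu' (h.inv_one_add_mul_mem hy hγ)
    · rw [hau, hbv]
      norm_cast
      field_simp
      ring

end IsChartAt

namespace HyperellipticCurve3

variable {K : Type*} [Field K] (H : HyperellipticCurve3 K)

theorem ordAt_zpow_mul {P : H.Point} {t u : H.FunctionField}
    (h : IsUniformizer (H.localRing P) t) (hu : u ∈ H.localRing P) (hu' : u⁻¹ ∈ H.localRing P)
    (hu0 : u ≠ 0) (n : ℤ) : H.ordAt P (t ^ n * u) = n := by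
  have hpos : ∀ (m : ℕ) (v : H.FunctionField) (_ : v ∈ H.localRing P) (_ : v⁻¹ ∈ H.localRing P)
      (_ : v ≠ 0) (f : H.FunctionField) (hf : f = t ^ m * v) (hm : f ∈ H.localRing P),
      ((Ring.ord (H.localRing P) ⟨f, hm⟩).toNat : ℤ) = m := by
    rintro m v hv hv' hv0 f rfl hm
    rw [h.ord_pow_mul hv hv' hv0]
    simp
  by_cases hn : 0 ≤ n
  · have hm := (h.zpow_mul_mem_iff hu hu' hu0 n).mpr hn
    lift n to ℕ using hn
    rw [ordAt, dif_pos hm]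
    exact hpos n u hu hu' hu0 _ (by simp) hm
  · have hm : t ^ n * u ∉ H.localRing P := fun hm => hn ((h.zpow_mul_mem_iff hu hu' hu0 n).mp hm)
    obtain ⟨m, rfl⟩ : ∃ m : ℕ, n = -(m : ℤ) := ⟨(-n).toNat, by omega⟩
    have hinv : (t ^ (-(m : ℤ)) * u)⁻¹ = t ^ m * u⁻¹ := by
      rw [mul_inv, zpow_neg, inv_inv, zpow_natCast]
    have hm' : (t ^ (-(m : ℤ)) * u)⁻¹ ∈ H.localRing P := by
      rw [hinv]
      exact Subring.mul_mem _ (Subring.pow_mem _ h.mem m) hu'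
    rw [ordAt, dif_neg hm, dif_pos hm',
      hpos m u⁻¹ hu' (by rwa [inv_inv]) (inv_ne_zero hu0) _ hinv hm']

variable {H}

theorem ordAt_eq_one {P : H.Point} {t : H.FunctionField}
    (h : IsUniformizer (H.localRing P) t) : H.ordAt P t = 1 := by
  simpa using H.ordAt_zpow_mul h (Subring.one_mem _) (by simp) one_ne_zero 1

theorem ordAt_eq_zero {P : H.Point} {t u : H.FunctionField}
    (h : IsUniformizer (H.localRing P) t) (hu : u ∈ H.localRing P) (hu' : u⁻¹ ∈ H.localRing P)
    (hu0 : u ≠ 0) : H.ordAt P u = 0 := by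
  simpa using H.ordAt_zpow_mul h hu hu' hu0 0

theorem ordAt_mul_of_isUniformizer {P : H.Point} {t f g : H.FunctionField}
    (h : IsUniformizer (H.localRing P) t) (hf : f ≠ 0) (hg : g ≠ 0) :
    H.ordAt P (f * g) = H.ordAt P f + H.ordAt P g := by
  obtain ⟨n, u, hu, hu', rfl⟩ := h.exists_eq_zpow_mul f hf
  obtain ⟨m, v, hv, hv', rfl⟩ := h.exists_eq_zpow_mul g hg
  have hu0 := (mul_ne_zero_iff.mp hf).2
  have hv0 := (mul_ne_zero_iff.mp hg).2
  rw [H.ordAt_zpow_mul h hu hu' hu0, H.ordAt_zpow_mul h hv hv' hv0, mul_mul_mul_comm,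
    ← zpow_add₀ h.ne_zero, H.ordAt_zpow_mul h (Subring.mul_mem _ hu hv)
      (by rw [mul_inv]; exact Subring.mul_mem _ hu' hv') (mul_ne_zero hu0 hv0)]

theorem mem_localRing_of_ordAt_nonneg {P : H.Point} {t f : H.FunctionField}
    (h : IsUniformizer (H.localRing P) t) (hf : f ≠ 0) (h0 : 0 ≤ H.ordAt P f) :
    f ∈ H.localRing P := by
  obtain ⟨n, u, hu, hu', rfl⟩ := h.exists_eq_zpow_mul f hf
  have hu0 := (mul_ne_zero_iff.mp hf).2
  rw [H.ordAt_zpow_mul h hu hu' hu0] at h0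
  exact (h.zpow_mul_mem_iff hu hu' hu0 n).mpr h0

/-! ### Values of forms and of functions at a point -/

theorem IsForm.eval₂_smul {G : MvPolynomial (Fin 3) K} {d : ℕ} (hG : IsForm G d) {S : Type*}
    [CommRing S] (i : K →+* S) (c : S) (z : Fin 3 → S) :
    MvPolynomial.eval₂ i ![c * z 0, c * z 1, c ^ 4 * z 2] G = c ^ d * MvPolynomial.eval₂ i z G := by
  rw [MvPolynomial.eval₂_eq', MvPolynomial.eval₂_eq', Finset.mul_sum]
  refine Finset.sum_congr rfl fun m hm => ?_
  have hd : m 0 + m 1 + 4 * m 2 = d := by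
    have := hG (MvPolynomial.mem_support_iff.mp hm)
    rw [Finsupp.weight_apply, Finsupp.sum_fintype _ _ (by simp)] at this
    simp [Fin.sum_univ_three] at this
    omega
  rw [← hd]
  simp [Fin.prod_univ_three]
  ring

theorem IsForm.nonvanishingAt_iff {G : MvPolynomial (Fin 3) K} {d : ℕ} (hG : IsForm G d)
    (p : H.Triple) : H.NonvanishingAt G ⟦p⟧ ↔ MvPolynomial.eval p.1 G ≠ 0 := by
  refine ⟨fun h => h p rfl, fun h q hq => ?_⟩
  obtain ⟨c, hc⟩ := Quotient.exact hq.symm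
  have := hG.eval₂_smul (RingHom.id K) (c : K) p.1
  rw [hc]
  change MvPolynomial.eval₂ (RingHom.id K) _ G ≠ 0
  rw [this]
  exact mul_ne_zero (pow_ne_zero _ c.ne_zero) h

variable (H) in
/-- The function `f` is regular at the point with homogeneous coordinates `p` and has the value `c`
there: it is a quotient `A / B` of forms of the same degree with `B(p) ≠ 0` and `A(p) / B(p) = c`.
-/
def HasValue (p : H.Triple) (f : H.FunctionField) (c : K) : Prop :=
  ∃ (d : ℕ) (A B : MvPolynomial (Fin 3) K), IsForm A d ∧ IsForm B d ∧
    MvPolynomial.eval p.1 B ≠ 0 ∧ f = H.dehomogenize A / H.dehomogenize B ∧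
    c = MvPolynomial.eval p.1 A / MvPolynomial.eval p.1 B

namespace HasValue

variable {p : H.Triple} {f g : H.FunctionField} {b c : K}

theorem mul (hf : H.HasValue p f b) (hg : H.HasValue p g c) : H.HasValue p (f * g) (b * c) := by
  obtain ⟨d, A, B, hA, hB, hp, rfl, rfl⟩ := hf
  obtain ⟨d', A', B', hA', hB', hp', rfl, rfl⟩ := hg
  refine ⟨d + d', A * A', B * B', hA.mul hA', hB.mul hB', ?_, ?_, ?_⟩
  · rw [map_mul]
    exact mul_ne_zero hp hp'
  · rw [map_mul, map_mul, div_mul_div_comm]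
  · rw [map_mul, map_mul, div_mul_div_comm]

/-- The hypothesis `hnz` says that a form without a zero at `p` is not the zero function. -/
theorem add (hnz : ∀ B d, IsForm B d → MvPolynomial.eval p.1 B ≠ 0 → H.dehomogenize B ≠ 0)
    (hf : H.HasValue p f b) (hg : H.HasValue p g c) : H.HasValue p (f + g) (b + c) := by
  obtain ⟨d, A, B, hA, hB, hp, rfl, rfl⟩ := hf
  obtain ⟨d', A', B', hA', hB', hp', rfl, rfl⟩ := hg
  refine ⟨d + d', A * B' + B * A', B * B', (hA.mul hB').add (hB.mul hA'), hB.mul hB', ?_, ?_, ?_⟩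
  · rw [map_mul]
    exact mul_ne_zero hp hp'
  · rw [map_mul, map_add, map_mul, map_mul, div_add_div _ _ (hnz _ _ hB hp) (hnz _ _ hB' hp')]
  · rw [map_mul, map_add, map_mul, map_mul, div_add_div _ _ hp hp']

theorem const (p : H.Triple) (c : K) : H.HasValue p (H.const c) c :=
  ⟨0, MvPolynomial.C c, 1, MvPolynomial.isWeightedHomogeneous_C _ _,
    MvPolynomial.isWeightedHomogeneous_one _ _, by simp, by simp [dehomogenize], by simp⟩

theorem inv (hf : H.HasValue p f c) (hc : c ≠ 0) : H.HasValue p f⁻¹ c⁻¹ := by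
  obtain ⟨d, A, B, hA, hB, hp, rfl, rfl⟩ := hf
  exact ⟨d, B, A, hB, hA, (div_ne_zero_iff.mp hc).1, by rw [inv_div], by rw [inv_div]⟩

theorem mem_localRing (hf : H.HasValue p f c) : f ∈ H.localRing ⟦p⟧ := by
  obtain ⟨d, A, B, hA, hB, hp, rfl, -⟩ := hf
  exact ⟨d, A, B, hA, hB, (hB.nonvanishingAt_iff p).mpr hp, rfl⟩

end HasValue

/-- A weighted homogeneous form in coordinates `(U(X), V(X), Y)` is `a(X) + b(X) Y`. -/
theorem exists_eval₂_eq {Φ : Type*} [Field Φ] {φ : K[X] →+* Φ} {Y : Φ} {F : K[X]}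
    (hsq : Y ^ 2 = φ F) (U V : K[X]) {x₀ y₀ : K} (hpt : y₀ ^ 2 = F.eval x₀)
    (A : MvPolynomial (Fin 3) K) :
    ∃ a b : K[X], MvPolynomial.eval₂ (φ.comp C) ![φ U, φ V, Y] A = φ a + φ b * Y ∧
      MvPolynomial.eval ![U.eval x₀, V.eval x₀, y₀] A = a.eval x₀ + b.eval x₀ * y₀ := by
  induction A using MvPolynomial.induction_on with
  | C c => exact ⟨C c, 0, by simp, by simp⟩
  | add A B hA hB =>
    obtain ⟨a, b, h1, h2⟩ := hA
    obtain ⟨a', b', h1', h2'⟩ := hB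
    refine ⟨a + a', b + b', ?_, ?_⟩
    · rw [MvPolynomial.eval₂_add, h1, h1', map_add, map_add]
      ring
    · rw [map_add, h2, h2', eval_add, eval_add]
      ring
  | mul_X A i hA =>
    obtain ⟨a, b, h1, h2⟩ := hA
    rw [MvPolynomial.eval₂_mul, MvPolynomial.eval₂_X, map_mul, MvPolynomial.eval_X, h1, h2]
    fin_cases i
    · exact ⟨a * U, b * U, by simp; ring, by simp; ring⟩
    · exact ⟨a * V, b * V, by simp; ring, by simp; ring⟩
    · refine ⟨b * F, a, ?_, ?_⟩
      · simp only [map_mul, ← hsq, Fin.reduceFinMk, Matrix.cons_val]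
        ring
      · simp only [eval_mul, ← hpt, Fin.reduceFinMk, Matrix.cons_val]
        ring

/-- The local ring of the curve at a point, read in a chart in which the coordinates `(u, v, w)` are
proportional to `(U(X), V(X), Y)`. -/
theorem mem_localRing_iff {φ : K[X] →+* H.FunctionField} {Y s : H.FunctionField} {G U V : K[X]}
    {x₀ y₀ : K} {p : H.Triple} (hC : φ.comp C = H.const) (hs : s ≠ 0) (hU : φ U = s * H.x)
    (hV : φ V = s) (hY : Y = s ^ 4 * H.y) (hsq : Y ^ 2 = φ G)
    (hind : ∀ a b, φ a + φ b * Y = 0 → a = 0 ∧ b = 0) (hpt : y₀ ^ 2 = G.eval x₀)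
    (hp : p.1 = ![U.eval x₀, V.eval x₀, y₀]) (hX : H.HasValue p (φ X) x₀)
    (hYv : H.HasValue p Y y₀) (f : H.FunctionField) :
    f ∈ H.localRing ⟦p⟧ ↔ ∃ a b c d : K[X], c.eval x₀ + d.eval x₀ * y₀ ≠ 0 ∧
      f = (φ a + φ b * Y) / (φ c + φ d * Y) := by
  have key : ∀ (A : MvPolynomial (Fin 3) K) (d : ℕ), IsForm A d → ∃ a b : K[X],
      s ^ d * H.dehomogenize A = φ a + φ b * Y ∧
      MvPolynomial.eval p.1 A = a.eval x₀ + b.eval x₀ * y₀ := by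
    intro A d hA
    obtain ⟨a, b, h1, h2⟩ := exists_eval₂_eq hsq U V hpt A
    refine ⟨a, b, ?_, by rw [hp, h2]⟩
    rw [← h1, hC, hU, hV, hY]
    simpa [dehomogenize] using (hA.eval₂_smul H.const s ![H.x, 1, H.y]).symm
  have hne : ∀ c d : K[X], c.eval x₀ + d.eval x₀ * y₀ ≠ 0 → φ c + φ d * Y ≠ 0 := by
    intro c d hcd h0
    obtain ⟨rfl, rfl⟩ := hind c d h0
    simp at hcd
  have hnz : ∀ B d, IsForm B d → MvPolynomial.eval p.1 B ≠ 0 → H.dehomogenize B ≠ 0 := by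
    intro B d hB hB0 h0
    obtain ⟨a, b, h1, h2⟩ := key B d hB
    refine hne a b (h2 ▸ hB0) ?_
    rw [← h1, h0, mul_zero]
  constructor
  · rintro ⟨d, A, B, hA, hB, hP, rfl⟩
    obtain ⟨a, b, h1, -⟩ := key A d hA
    obtain ⟨a', b', h1', h2'⟩ := key B d hB
    refine ⟨a, b, a', b', h2' ▸ (hB.nonvanishingAt_iff p).mp hP, ?_⟩
    rw [← h1, ← h1', mul_div_mul_left _ _ (pow_ne_zero _ hs)]
  · rintro ⟨a, b, c, d, hcd, rfl⟩
    have hpoly : ∀ a : K[X], H.HasValue p (φ a) (a.eval x₀) := by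
      intro a
      have hc : ∀ c, H.HasValue p (φ (C c)) c := fun c => by
        have := HasValue.const p c
        rwa [← hC] at this
      induction a using Polynomial.induction_on with
      | C c => simpa using hc c
      | add a b ha hb => simpa using ha.add hnz hb
      | monomial n c h =>
        rw [pow_succ, ← mul_assoc, map_mul, eval_mul, eval_X]
        exact h.mul hX
    have hadd : ∀ a b : K[X], H.HasValue p (φ a + φ b * Y) (a.eval x₀ + b.eval x₀ * y₀) :=
      fun a b => (hpoly a).add hnz ((hpoly b).mul hYv)
    exact ((hadd a b).mul ((hadd c d).inv hcd)).mem_localRing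

end HyperellipticCurve3

namespace HyperellipticCurve3

variable {K : Type*} [Field K] {H : HyperellipticCurve3 K}

/-! ### The two charts of the curve -/

variable (H) in
/-- The embedding `a ↦ a(x)` of the polynomial ring in the function field. -/
noncomputable def ofX : K[X] →+* H.FunctionField :=
  (algebraMap H.CoordinateRing H.FunctionField).comp (AdjoinRoot.of H.equation)

variable (H) in
/-- The embedding `a ↦ a(1 / x)` of the polynomial ring in the function field. -/
noncomputable def ofInvX : K[X] →+* H.FunctionField := eval₂RingHom H.const H.x⁻¹

theorem ofX_X : H.ofX X = H.x := rfl

theorem ofX_comp_C : H.ofX.comp C = H.const := rfl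

theorem ofInvX_X : H.ofInvX X = H.x⁻¹ := by simp [ofInvX]

theorem ofInvX_comp_C : H.ofInvX.comp C = H.const := by
  ext a
  simp [ofInvX]

theorem natDegree_le : H.F.natDegree ≤ 8 := by
  rcases H.natDegree_eq with h | h <;> omega

theorem F_ne_zero : H.F ≠ 0 := by
  intro h0
  rcases H.natDegree_eq with h | h <;> simp [h0] at h

theorem monic_equation : H.equation.Monic := monic_X_pow_sub_C _ two_ne_zero

theorem y_sq : H.y ^ 2 = H.ofX H.F := by
  have h : AdjoinRoot.mk H.equation H.equation = 0 := AdjoinRoot.mk_self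
  rw [equation, map_sub, map_pow, sub_eq_zero] at h
  rw [y, ← map_pow]
  exact congrArg _ h

theorem ofX_add_mul_y_eq_zero (a b : K[X]) (h : H.ofX a + H.ofX b * H.y = 0) : a = 0 ∧ b = 0 := by
  have h1 : algebraMap H.CoordinateRing H.FunctionField
      (AdjoinRoot.mk H.equation (C a + C b * X)) = 0 := by
    simpa [ofX, y] using h
  rw [map_eq_zero_iff _ (IsFractionRing.injective _ _)] at h1
  have h2 : C a + C b * X = 0 := by
    by_contra h0
    refine AdjoinRoot.mk_ne_zero_of_degree_lt H.monic_equation h0 ?_ h1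
    rw [show H.equation.degree = 2 from degree_X_pow_sub_C two_pos _, add_comm]
    exact lt_of_le_of_lt degree_linear_le (by norm_num)
  refine ⟨by simpa using congrArg (fun p => p.coeff 0) h2,
    by simpa using congrArg (fun p => p.coeff 1) h2⟩

theorem ofX_ne_zero {a : K[X]} (ha : a ≠ 0) : H.ofX a ≠ 0 := fun h =>
  ha (ofX_add_mul_y_eq_zero (H := H) a 0 (by simp [h])).1

theorem x_ne_zero : H.x ≠ 0 := ofX_X (H := H) ▸ ofX_ne_zero X_ne_zero

theorem y_ne_zero : H.y ≠ 0 := by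
  intro h
  simpa using ofX_add_mul_y_eq_zero (H := H) 0 1 (by simp [h])

theorem exists_eq_ofX_div (f : H.FunctionField) :
    ∃ a b c, c ≠ 0 ∧ f = (H.ofX a + H.ofX b * H.y) / H.ofX c := by
  have hlin : ∀ r : H.CoordinateRing, ∃ a b : K[X],
      algebraMap H.CoordinateRing H.FunctionField r = H.ofX a + H.ofX b * H.y := by
    intro r
    induction r using AdjoinRoot.induction_on with
    | ih q =>
      induction q using Polynomial.induction_on with
      | C a => exact ⟨a, 0, by simp [ofX]⟩
      | add q q' h h' =>
        obtain ⟨a, b, h⟩ := h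
        obtain ⟨a', b', h'⟩ := h'
        exact ⟨a + a', b + b', by rw [map_add, map_add, h, h', map_add, map_add]; ring⟩
      | monomial n c h =>
        obtain ⟨a, b, h⟩ := h
        refine ⟨b * H.F, a, ?_⟩
        rw [pow_succ, ← mul_assoc, map_mul, map_mul, h, map_mul, ← y_sq, AdjoinRoot.mk_X]
        change _ * H.y = _
        ring
  obtain ⟨r, s, hs, rfl⟩ := IsFractionRing.div_surjective H.CoordinateRing f
  obtain ⟨a, b, hr⟩ := hlin r
  obtain ⟨c, d, hs'⟩ := hlin s
  have hs0 : H.ofX c + H.ofX d * H.y ≠ 0 := by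
    rw [← hs']
    exact IsFractionRing.to_map_ne_zero_of_mem_nonZeroDivisors hs
  -- Multiply by the conjugate `c - d y` of the denominator.
  have hconj : H.ofX c + H.ofX (-d) * H.y ≠ 0 := by
    intro h0
    obtain ⟨rfl, hd⟩ := ofX_add_mul_y_eq_zero _ _ h0
    rw [neg_eq_zero] at hd
    exact hs0 (by simp [hd])
  have hnorm : H.ofX (c ^ 2 - d ^ 2 * H.F) =
      (H.ofX c + H.ofX d * H.y) * (H.ofX c + H.ofX (-d) * H.y) := by
    simp only [map_sub, map_mul, map_pow, map_neg, ← y_sq]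
    ring
  refine ⟨a * c - b * d * H.F, b * c - a * d, c ^ 2 - d ^ 2 * H.F, ?_, ?_⟩
  · intro h0
    rw [h0, map_zero] at hnorm
    exact mul_ne_zero hs0 hconj hnorm.symm
  · rw [hnorm, hr, hs', div_eq_div_iff hs0 (mul_ne_zero hs0 hconj)]
    simp only [map_sub, map_mul, map_neg, ← y_sq]
    ring

theorem ofInvX_reflect {N : ℕ} {a : K[X]} (ha : a.natDegree ≤ N) :
    H.ofInvX (reflect N a) * H.x ^ N = H.ofX a := by
  let : Invertible H.x := invertibleOfNonzero x_ne_zero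
  have h := eval₂_reflect_mul_pow H.const H.x N a ha
  rw [invOf_eq_inv] at h
  refine h.trans ?_
  have : eval₂RingHom H.const H.x = H.ofX := by
    refine Polynomial.ringHom_ext (fun c => ?_) ?_
    · simp [← ofX_comp_C]
    · simp [ofX_X]
  exact RingHom.congr_fun this a

theorem ofX_reflect {N : ℕ} {a : K[X]} (ha : a.natDegree ≤ N) :
    H.ofX (reflect N a) = H.ofInvX a * H.x ^ N := by
  rw [← ofInvX_reflect (N := N) (natDegree_reflect_le.trans (by simp [ha])), reflect_reflect]

variable (H) in
/-- The coordinate `w / u⁴ = y / x⁴` of the chart at infinity. -/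
noncomputable def yInf : H.FunctionField := (H.x⁻¹) ^ 4 * H.y

theorem yInf_sq : H.yInf ^ 2 = H.ofInvX (reflect 8 H.F) := by
  have h := ofInvX_reflect (H := H) (natDegree_le (H := H))
  rw [← y_sq] at h
  have hx := x_ne_zero (H := H)
  rw [yInf, mul_pow, ← h]
  field_simp

theorem ofInvX_add_mul_yInf_eq_zero (a b : K[X]) (h : H.ofInvX a + H.ofInvX b * H.yInf = 0) :
    a = 0 ∧ b = 0 := by
  have hx := x_ne_zero (H := H)
  obtain ⟨N, hNa, hNb⟩ : ∃ N, a.natDegree ≤ N ∧ b.natDegree ≤ N :=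
    ⟨_, le_max_left _ _, le_max_right _ _⟩
  have h1 := ofX_reflect (H := H) hNa
  have h2 := ofX_reflect (H := H) hNb
  have h3 := ofX_add_mul_y_eq_zero (H := H) (reflect N a * X ^ 4) (reflect N b) (by
    rw [map_mul, map_pow, ofX_X, h1, h2]
    have h4 : H.y = H.yInf * H.x ^ 4 := by
      rw [yInf]
      field_simp
    rw [h4]
    linear_combination H.x ^ N * H.x ^ 4 * h)
  simpa using h3

theorem ofInvX_ne_zero {a : K[X]} (ha : a ≠ 0) : H.ofInvX a ≠ 0 := fun h =>
  ha (ofInvX_add_mul_yInf_eq_zero (H := H) a 0 (by simp [h])).1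

theorem exists_eq_ofInvX_div (f : H.FunctionField) :
    ∃ a b c, c ≠ 0 ∧ f = (H.ofInvX a + H.ofInvX b * H.yInf) / H.ofInvX c := by
  have hx := x_ne_zero (H := H)
  obtain ⟨a, b, c, hc, rfl⟩ := exists_eq_ofX_div f
  obtain ⟨N, hNa, hNb, hNc⟩ : ∃ N, a.natDegree ≤ N ∧ b.natDegree ≤ N ∧ c.natDegree ≤ N :=
    ⟨max a.natDegree (max b.natDegree c.natDegree), by omega, by omega, by omega⟩
  refine ⟨reflect N a * X ^ 4, reflect N b, reflect N c * X ^ 4, by simpa using hc, ?_⟩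
  have hc' : H.ofInvX (reflect N c) ≠ 0 := ofInvX_ne_zero (by simpa using hc)
  rw [← ofInvX_reflect hNa, ← ofInvX_reflect hNb, ← ofInvX_reflect hNc, map_mul, map_mul, map_pow,
    ofInvX_X, yInf]
  field_simp

theorem eval_form_one (x₀ : K) : MvPolynomial.eval ![x₀, 1] H.form = H.F.eval x₀ := by
  rw [form, eval_homogenize natDegree_le _ (by simp)]
  simp

theorem eval_form_zero (u : K) : MvPolynomial.eval ![u, 0] H.form = H.F.coeff 8 * u ^ 8 := by
  rw [form, MvPolynomial.eval_eq', Finset.sum_eq_single (Finsupp.single 0 8)]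
  · simp [coeff_homogenize]
  · intro m hm hne
    rw [MvPolynomial.mem_support_iff, coeff_homogenize] at hm
    have hm1 : m 1 ≠ 0 := by
      intro h1
      refine hne (Finsupp.ext fun i => ?_)
      have : m 0 + m 1 = 8 := by
        by_contra h
        simp [h] at hm
      fin_cases i
      · simp; omega
      · simpa using h1
    simp [Fin.prod_univ_two, hm1]
  · intro h
    rw [MvPolynomial.notMem_support_iff] at h
    rw [h, zero_mul]

variable (H) in
/-- Homogeneous coordinates of the point `(x₀ : 1 : y₀)`. -/
def affineTriple (x₀ y₀ : K) (h : y₀ ^ 2 = H.F.eval x₀) : H.Triple :=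
  ⟨![x₀, 1, y₀], fun h0 => by simpa using congrFun h0 1, by simpa [eval_form_one] using h⟩

variable (H) in
/-- Homogeneous coordinates of the point `(1 : 0 : y₀)` at infinity. -/
def infiniteTriple (y₀ : K) (h : y₀ ^ 2 = H.F.coeff 8) : H.Triple :=
  ⟨![1, 0, y₀], fun h0 => by simpa using congrFun h0 0, by simpa [eval_form_zero] using h⟩

variable (H) in
/-- The point `(x₀ : 1 : y₀)`. -/
def affinePoint (x₀ y₀ : K) (h : y₀ ^ 2 = H.F.eval x₀) : H.Point := ⟦H.affineTriple x₀ y₀ h⟧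

variable (H) in
/-- The point `(1 : 0 : y₀)` at infinity. -/
def infinitePoint (y₀ : K) (h : y₀ ^ 2 = H.F.coeff 8) : H.Point := ⟦H.infiniteTriple y₀ h⟧

theorem exists_eq_affinePoint_or (P : H.Point) :
    (∃ x₀ y₀ h, P = H.affinePoint x₀ y₀ h) ∨ ∃ y₀ h, P = H.infinitePoint y₀ h := by
  induction P using Quotient.inductionOn with
  | h p =>
    obtain ⟨p, hp0, hp⟩ := p
    by_cases hv : p 1 = 0
    · have hu : p 0 ≠ 0 := by
        intro hu
        refine hp0 (funext fun i => ?_)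
        rw [hu, hv, eval_form_zero] at hp
        fin_cases i
        · exact hu
        · exact hv
        · simpa using hp
      rw [hv, eval_form_zero] at hp
      refine Or.inr ⟨(p 0)⁻¹ ^ 4 * p 2, ?_, Quotient.sound ⟨(Units.mk0 _ hu)⁻¹, ?_⟩⟩
      · rw [mul_pow, hp]
        field_simp
      · ext i
        fin_cases i <;> simp [infiniteTriple, hu, hv]
    · rw [form, eval_homogenize natDegree_le _ (by simpa using hv)] at hp
      refine Or.inl ⟨p 0 / p 1, (p 1)⁻¹ ^ 4 * p 2, ?_, Quotient.sound ⟨(Units.mk0 _ hv)⁻¹, ?_⟩⟩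
      · rw [mul_pow, hp]
        simp
        field_simp
      · ext i
        fin_cases i <;> simp [affineTriple, hv, div_eq_inv_mul]

theorem mem_weierstrassPoints_mk (p : H.Triple) :
    (⟦p⟧ : H.Point) ∈ H.weierstrassPoints ↔ p.1 2 = 0 := by
  refine ⟨?_, fun h => ⟨p, rfl, h⟩⟩
  rintro ⟨q, hq, h0⟩
  obtain ⟨c, hc⟩ := Quotient.exact hq
  simp [hc, h0]

theorem affinePoint_mem_weierstrassPoints {x₀ y₀ : K} {h : y₀ ^ 2 = H.F.eval x₀} :
    H.affinePoint x₀ y₀ h ∈ H.weierstrassPoints ↔ y₀ = 0 := mem_weierstrassPoints_mk _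

theorem infinitePoint_mem_weierstrassPoints {y₀ : K} {h : y₀ ^ 2 = H.F.coeff 8} :
    H.infinitePoint y₀ h ∈ H.weierstrassPoints ↔ y₀ = 0 := mem_weierstrassPoints_mk _

/-- A square-free polynomial has simple roots. -/
theorem exists_eq_mul_of_eval_eq_zero {x₀ : K} (h : H.F.eval x₀ = 0) :
    ∃ G₁, H.F = (X - C x₀) * G₁ ∧ G₁.eval x₀ ≠ 0 := by
  obtain ⟨G₁, hG⟩ := dvd_iff_isRoot.mpr h
  refine ⟨G₁, hG, fun h1 => ?_⟩
  obtain ⟨G₂, rfl⟩ := dvd_iff_isRoot.mpr h1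
  exact not_isUnit_X_sub_C x₀ (H.squarefree _ ⟨G₂, by rw [hG]; ring⟩)

theorem coeff_zero_reflect (N : ℕ) (a : K[X]) : (reflect N a).eval 0 = a.coeff N := by
  rw [← coeff_zero_eq_eval_zero, coeff_reflect, revAt_zero]

/-- The local ring at the point `(x₀ : 1 : y₀)` in the chart `y² = F(x)`. -/
theorem isChartAt_affinePoint (x₀ y₀ : K) (h : y₀ ^ 2 = H.F.eval x₀) :
    IsChartAt H.ofX H.y H.F (H.localRing (H.affinePoint x₀ y₀ h)) x₀ y₀ where
  sq_eq := y_sq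
  eq_zero := ofX_add_mul_y_eq_zero
  exists_eq_div := exists_eq_ofX_div
  eval_eq := h
  simple := by
    rintro rfl
    exact exists_eq_mul_of_eval_eq_zero (by simpa using h.symm)
  mem_iff := by
    refine mem_localRing_iff (s := 1) (U := X) (V := 1) ofX_comp_C one_ne_zero (by simp [ofX_X])
      (by simp) (by simp) y_sq ofX_add_mul_y_eq_zero h (by simp [affineTriple]) ?_ ?_
    · exact ⟨1, MvPolynomial.X 0, MvPolynomial.X 1, MvPolynomial.isWeightedHomogeneous_X _ _ 0,
        MvPolynomial.isWeightedHomogeneous_X _ _ 1, by simp [affineTriple],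
        by simp [dehomogenize, ofX_X], by simp [affineTriple]⟩
    · exact ⟨4, MvPolynomial.X 2, MvPolynomial.X 1 ^ 4, MvPolynomial.isWeightedHomogeneous_X _ _ 2,
        (MvPolynomial.isWeightedHomogeneous_X _ _ 1).pow 4, by simp [affineTriple],
        by simp [dehomogenize], by simp [affineTriple]⟩

/-- The local ring at the point `(1 : 0 : y₀)` in the chart `(y / x⁴)² = x⁻⁸ F(x)` with coordinates
`1 / x` and `y / x⁴`. -/
theorem isChartAt_infinitePoint (y₀ : K) (h : y₀ ^ 2 = H.F.coeff 8) :
    IsChartAt H.ofInvX H.yInf (reflect 8 H.F) (H.localRing (H.infinitePoint y₀ h)) 0 y₀ where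
  sq_eq := yInf_sq
  eq_zero := ofInvX_add_mul_yInf_eq_zero
  exists_eq_div := exists_eq_ofInvX_div
  eval_eq := by rw [coeff_zero_reflect, h]
  simple := by
    rintro rfl
    have h8 : H.F.coeff 8 = 0 := by simpa using h.symm
    have h7 : H.F.natDegree = 7 := by
      refine H.natDegree_eq.resolve_right fun h' => F_ne_zero (H := H) ?_
      rwa [← leadingCoeff_eq_zero, leadingCoeff, h']
    refine ⟨reflect 7 H.F, ?_, ?_⟩
    · ext n
      rcases n with _ | n
      · simp [coeff_reflect, h8]
      · rw [C_0, sub_zero, coeff_X_mul, coeff_reflect, coeff_reflect]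
        by_cases hn : n ≤ 7
        · rw [revAt_le hn, revAt_le (by omega)]
          congr 1
          omega
        · rw [revAt_eq_self_of_lt (by omega), revAt_eq_self_of_lt (by omega),
            coeff_eq_zero_of_natDegree_lt (by omega), coeff_eq_zero_of_natDegree_lt (by omega)]
    · rw [coeff_zero_reflect, ← h7]
      exact leadingCoeff_ne_zero.mpr F_ne_zero
  mem_iff := by
    have hx := x_ne_zero (H := H)
    refine mem_localRing_iff (s := H.x⁻¹) (U := 1) (V := X) ofInvX_comp_C (inv_ne_zero hx)
      (by simp [hx]) ofInvX_X rfl yInf_sq ofInvX_add_mul_yInf_eq_zero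
      (by rw [coeff_zero_reflect, h]) (by simp [infiniteTriple]) ?_ ?_
    · exact ⟨1, MvPolynomial.X 1, MvPolynomial.X 0, MvPolynomial.isWeightedHomogeneous_X _ _ 1,
        MvPolynomial.isWeightedHomogeneous_X _ _ 0, by simp [infiniteTriple],
        by simp [dehomogenize, ofInvX_X], by simp [infiniteTriple]⟩
    · exact ⟨4, MvPolynomial.X 2, MvPolynomial.X 0 ^ 4, MvPolynomial.isWeightedHomogeneous_X _ _ 2,
        (MvPolynomial.isWeightedHomogeneous_X _ _ 0).pow 4, by simp [infiniteTriple],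
        by simp [dehomogenize, yInf, div_eq_inv_mul], by simp [infiniteTriple]⟩

end HyperellipticCurve3

namespace HyperellipticCurve3

variable {K : Type*} [Field K] {H : HyperellipticCurve3 K}

/-! ### Orders of functions -/

section Chart

variable {P : H.Point} {φ : K[X] →+* H.FunctionField} {Y : H.FunctionField} {G : K[X]} {x₀ y₀ : K}

theorem _root_.IsChartAt.exists_isUniformizer (h2 : (2 : K) ≠ 0)
    (h : IsChartAt φ Y G (H.localRing P) x₀ y₀) : ∃ t, IsUniformizer (H.localRing P) t := by
  by_cases hy : y₀ = 0
  · exact ⟨_, h.isUniformizer_root h2 hy⟩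
  · exact ⟨_, h.isUniformizer_map h2 hy⟩

theorem _root_.IsChartAt.ordAt_map_eq_zero (h2 : (2 : K) ≠ 0)
    (h : IsChartAt φ Y G (H.localRing P) x₀ y₀) {a : K[X]} (ha : a.eval x₀ ≠ 0) :
    H.ordAt P (φ a) = 0 := by
  obtain ⟨t, ht⟩ := h.exists_isUniformizer h2
  exact ordAt_eq_zero ht (h.map_mem a) (h.inv_map_mem ha)
    (h.map_ne_zero fun h0 => ha (by simp [h0]))

open Classical in
theorem _root_.IsChartAt.ordAt_coord (h2 : (2 : K) ≠ 0)
    (h : IsChartAt φ Y G (H.localRing P) x₀ y₀) :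
    H.ordAt P Y = if y₀ = 0 then 1 else 0 := by
  split_ifs with hy
  · exact ordAt_eq_one (h.isUniformizer_root h2 hy)
  · have hv : (0 : K[X]).eval x₀ + (1 : K[X]).eval x₀ * y₀ ≠ 0 := by simpa using hy
    have hm := h.add_mem 0 1
    have hm' := h.inv_add_mem hv
    have h0 := h.add_ne_zero hv
    simp only [map_zero, map_one, zero_add, one_mul] at hm hm' h0
    exact ordAt_eq_zero (h.isUniformizer_map h2 hy) hm hm' h0

theorem _root_.IsChartAt.even_ordAt_map (h2 : (2 : K) ≠ 0)
    (h : IsChartAt φ Y G (H.localRing P) x₀ y₀) (hy : y₀ = 0) {a : K[X]} (ha : a ≠ 0) :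
    Even (H.ordAt P (φ a)) := by
  obtain ⟨r, u, hu, hu', hau⟩ := h.exists_eq_even_pow hy ha
  have hu0 : u ≠ 0 := by
    rintro rfl
    exact h.map_ne_zero ha (by simp [hau])
  have := H.ordAt_zpow_mul (h.isUniformizer_root h2 hy) hu hu' hu0 ((2 * r : ℕ) : ℤ)
  rw [hau, ← zpow_natCast, this]
  simp

open Classical in
theorem _root_.IsChartAt.ordAt_map_X_sub_C (h2 : (2 : K) ≠ 0)
    (h : IsChartAt φ Y G (H.localRing P) x₀ y₀) :
    H.ordAt P (φ (X - C x₀)) = if y₀ = 0 then 2 else 1 := by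
  split_ifs with hy
  · have ht := h.isUniformizer_root h2 hy
    obtain ⟨G₁, hG, hG₁⟩ := h.simple hy
    have hG0 : φ G₁ ≠ 0 := h.map_ne_zero fun h0 => hG₁ (by simp [h0])
    have h1 := ordAt_mul_of_isUniformizer ht (h.map_ne_zero (X_sub_C_ne_zero x₀)) hG0
    rw [← map_mul, ← hG, ← h.sq_eq, pow_two, ordAt_mul_of_isUniformizer ht ht.ne_zero ht.ne_zero,
      ordAt_eq_one ht, h.ordAt_map_eq_zero h2 hG₁] at h1
    omega
  · exact ordAt_eq_one (h.isUniformizer_map h2 hy)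

end Chart

theorem exists_isUniformizer (h2 : (2 : K) ≠ 0) (P : H.Point) :
    ∃ t, IsUniformizer (H.localRing P) t := by
  rcases exists_eq_affinePoint_or P with ⟨x₀, y₀, h, rfl⟩ | ⟨y₀, h, rfl⟩
  · exact (isChartAt_affinePoint x₀ y₀ h).exists_isUniformizer h2
  · exact (isChartAt_infinitePoint y₀ h).exists_isUniformizer h2

theorem ordAt_mul (h2 : (2 : K) ≠ 0) (P : H.Point) {f g : H.FunctionField} (hf : f ≠ 0)
    (hg : g ≠ 0) : H.ordAt P (f * g) = H.ordAt P f + H.ordAt P g := by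
  obtain ⟨t, ht⟩ := exists_isUniformizer h2 P
  exact ordAt_mul_of_isUniformizer ht hf hg

theorem ordAt_one (h2 : (2 : K) ≠ 0) (P : H.Point) : H.ordAt P 1 = 0 := by
  have := ordAt_mul h2 P (one_ne_zero (α := H.FunctionField)) one_ne_zero
  rw [mul_one] at this
  omega

theorem ordAt_inv (h2 : (2 : K) ≠ 0) (P : H.Point) {f : H.FunctionField} (hf : f ≠ 0) :
    H.ordAt P f⁻¹ = -H.ordAt P f := by
  have := ordAt_mul h2 P hf (inv_ne_zero hf)
  rw [mul_inv_cancel₀ hf, ordAt_one h2] at this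
  omega

theorem ordAt_div (h2 : (2 : K) ≠ 0) (P : H.Point) {f g : H.FunctionField} (hf : f ≠ 0)
    (hg : g ≠ 0) : H.ordAt P (f / g) = H.ordAt P f - H.ordAt P g := by
  rw [div_eq_mul_inv, ordAt_mul h2 P hf (inv_ne_zero hg), ordAt_inv h2 P hg, sub_eq_add_neg]

theorem ordAt_pow (h2 : (2 : K) ≠ 0) (P : H.Point) {f : H.FunctionField} (hf : f ≠ 0) (n : ℕ) :
    H.ordAt P (f ^ n) = n * H.ordAt P f := by
  induction n with
  | zero => simp [ordAt_one h2]
  | succ n ih =>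
    rw [pow_succ, ordAt_mul h2 P (pow_ne_zero n hf) hf, ih]
    push_cast
    ring

theorem ordAt_prod (h2 : (2 : K) ≠ 0) (P : H.Point) {ι : Type*} (s : Finset ι)
    (f : ι → H.FunctionField) (hf : ∀ i, f i ≠ 0) :
    H.ordAt P (∏ i ∈ s, f i) = ∑ i ∈ s, H.ordAt P (f i) := by
  classical
  induction s using Finset.induction_on with
  | empty => simp [ordAt_one h2]
  | insert i s hi ih =>
    rw [Finset.prod_insert hi, Finset.sum_insert hi,
      ordAt_mul h2 P (hf i) (Finset.prod_ne_zero_iff.mpr fun j _ => hf j), ih]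

variable (H) in
/-- The negative of the order of vanishing of the coordinate `v` at `P`: zero at the affine points,
and the order of `x = u / v` at the points at infinity. -/
noncomputable def poleOrd (P : H.Point) : ℤ := min 0 (H.ordAt P H.x)

theorem poleOrd_nonpos (P : H.Point) : H.poleOrd P ≤ 0 := min_le_left _ _

theorem poleOrd_affinePoint (h2 : (2 : K) ≠ 0) {x₀ y₀ : K} (h : y₀ ^ 2 = H.F.eval x₀) :
    H.poleOrd (H.affinePoint x₀ y₀ h) = 0 := by
  have hc := isChartAt_affinePoint x₀ y₀ h
  refine min_eq_left ?_
  by_cases hx : x₀ = 0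
  · subst hx
    have := hc.ordAt_map_X_sub_C h2
    rw [C_0, sub_zero, ofX_X] at this
    rw [this]
    split_ifs <;> norm_num
  · have := hc.ordAt_map_eq_zero h2 (a := X) (by simpa using hx)
    rw [ofX_X] at this
    rw [this]

open Classical in
theorem ordAt_x_infinitePoint (h2 : (2 : K) ≠ 0) {y₀ : K} (h : y₀ ^ 2 = H.F.coeff 8) :
    H.ordAt (H.infinitePoint y₀ h) H.x = if y₀ = 0 then -2 else -1 := by
  have := (isChartAt_infinitePoint y₀ h).ordAt_map_X_sub_C h2
  rw [C_0, sub_zero, ofInvX_X, ordAt_inv h2 _ x_ne_zero] at this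
  split_ifs at this ⊢ <;> omega

theorem poleOrd_infinitePoint (h2 : (2 : K) ≠ 0) {y₀ : K} (h : y₀ ^ 2 = H.F.coeff 8) :
    H.poleOrd (H.infinitePoint y₀ h) = H.ordAt (H.infinitePoint y₀ h) H.x := by
  classical
  refine min_eq_right ?_
  rw [ordAt_x_infinitePoint h2]
  split_ifs <;> norm_num

open Classical in
/-- The divisor of `w = y v⁴` is the sum of the Weierstrass points. -/
theorem ordAt_y (h2 : (2 : K) ≠ 0) (P : H.Point) :
    H.ordAt P H.y = (if P ∈ H.weierstrassPoints then 1 else 0) + 4 * H.poleOrd P := by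
  rcases exists_eq_affinePoint_or P with ⟨x₀, y₀, h, rfl⟩ | ⟨y₀, h, rfl⟩
  · rw [poleOrd_affinePoint h2, (isChartAt_affinePoint x₀ y₀ h).ordAt_coord h2]
    simp [affinePoint_mem_weierstrassPoints]
  · have h1 := (isChartAt_infinitePoint y₀ h).ordAt_coord h2
    rw [yInf, ordAt_mul h2 _ (pow_ne_zero _ (inv_ne_zero x_ne_zero)) y_ne_zero,
      ordAt_pow h2 _ (inv_ne_zero x_ne_zero), ordAt_inv h2 _ x_ne_zero,
      ← poleOrd_infinitePoint h2] at h1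
    simp only [infinitePoint_mem_weierstrassPoints]
    rw [← h1]
    push_cast
    ring

theorem ordAt_ofX_infinitePoint (h2 : (2 : K) ≠ 0) {y₀ : K} (h : y₀ ^ 2 = H.F.coeff 8) {N : ℕ}
    {a : K[X]} (ha : a ≠ 0) (hN : a.natDegree ≤ N) :
    H.ordAt (H.infinitePoint y₀ h) (H.ofX a) =
      H.ordAt (H.infinitePoint y₀ h) (H.ofInvX (reflect N a)) +
        N * H.poleOrd (H.infinitePoint y₀ h) := by
  rw [← ofInvX_reflect hN, ordAt_mul h2 _ (ofInvX_ne_zero (by simpa using ha))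
    (pow_ne_zero _ x_ne_zero), ordAt_pow h2 _ x_ne_zero, poleOrd_infinitePoint h2]

/-- Functions of `x` are invariant under the hyperelliptic involution, so they have even order at
the Weierstrass points. -/
theorem even_ordAt_ofX (h2 : (2 : K) ≠ 0) {W : H.Point} (hW : W ∈ H.weierstrassPoints) {a : K[X]}
    (ha : a ≠ 0) : Even (H.ordAt W (H.ofX a)) := by
  rcases exists_eq_affinePoint_or W with ⟨x₀, y₀, h, rfl⟩ | ⟨y₀, h, rfl⟩
  · exact (isChartAt_affinePoint x₀ y₀ h).even_ordAt_map h2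
      (affinePoint_mem_weierstrassPoints.mp hW) ha
  · have hy := infinitePoint_mem_weierstrassPoints.mp hW
    rw [ordAt_ofX_infinitePoint h2 h ha le_rfl, poleOrd_infinitePoint h2,
      ordAt_x_infinitePoint h2, if_pos hy]
    refine ((isChartAt_infinitePoint y₀ h).even_ordAt_map h2 hy (by simpa using ha)).add ?_
    exact (even_neg.mpr even_two).mul_left _

theorem even_poleOrd (h2 : (2 : K) ≠ 0) {W : H.Point} (hW : W ∈ H.weierstrassPoints) :
    Even (H.poleOrd W) := by
  have h := even_ordAt_ofX h2 hW X_ne_zero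
  rw [ofX_X] at h
  rcases min_choice 0 (H.ordAt W H.x) with h' | h' <;> rw [poleOrd, h']
  · exact Even.zero
  · exact h

theorem affinePoint_ne_infinitePoint {x₀ y₀ y₁ : K} {h : y₀ ^ 2 = H.F.eval x₀}
    {h' : y₁ ^ 2 = H.F.coeff 8} : H.affinePoint x₀ y₀ h ≠ H.infinitePoint y₁ h' := by
  intro heq
  obtain ⟨c, hc⟩ := Quotient.exact heq
  exact c.ne_zero (by simpa [affineTriple, infiniteTriple] using (congrFun hc 1).symm)

theorem eq_of_affinePoint_eq {x₀ y₀ x₁ y₁ : K} {h : y₀ ^ 2 = H.F.eval x₀}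
    {h' : y₁ ^ 2 = H.F.eval x₁} (heq : H.affinePoint x₀ y₀ h = H.affinePoint x₁ y₁ h') :
    x₁ = x₀ := by
  obtain ⟨c, hc⟩ := Quotient.exact heq
  have h0 := congrFun hc 0
  have h1 := congrFun hc 1
  simp [affineTriple] at h0 h1
  rw [h0, ← h1, one_mul]

open Classical in
/-- For a Weierstrass point `W` there is a linear form in `u, v` with divisor `2 W`. -/
theorem exists_ordAt_ofX_eq (h2 : (2 : K) ≠ 0) {W : H.Point} (hW : W ∈ H.weierstrassPoints) :
    ∃ l : K[X], l ≠ 0 ∧ ∀ P, H.ordAt P (H.ofX l) = (if P = W then 2 else 0) + H.poleOrd P := by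
  rcases exists_eq_affinePoint_or W with ⟨x₁, y₁, h₁, rfl⟩ | ⟨y₁, h₁, rfl⟩
  · obtain rfl := affinePoint_mem_weierstrassPoints.mp hW
    refine ⟨X - C x₁, X_sub_C_ne_zero x₁, fun P => ?_⟩
    rcases exists_eq_affinePoint_or P with ⟨x₀, y₀, h, rfl⟩ | ⟨y₀, h, rfl⟩
    · rw [poleOrd_affinePoint h2, add_zero]
      by_cases hx : x₀ = x₁
      · subst hx
        obtain rfl : y₀ = 0 := by
          rw [← h₁] at h
          simpa using h
        rw [(isChartAt_affinePoint x₀ 0 h).ordAt_map_X_sub_C h2]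
        simp
      · rw [(isChartAt_affinePoint x₀ y₀ h).ordAt_map_eq_zero h2 (by simpa [sub_eq_zero] using hx),
          if_neg fun heq => hx (eq_of_affinePoint_eq heq).symm]
    · rw [if_neg affinePoint_ne_infinitePoint.symm, zero_add,
        ordAt_ofX_infinitePoint h2 h (X_sub_C_ne_zero x₁) (natDegree_X_sub_C x₁).le,
        (isChartAt_infinitePoint y₀ h).ordAt_map_eq_zero h2 (by simp)]
      simp
  · obtain rfl := infinitePoint_mem_weierstrassPoints.mp hW
    refine ⟨1, one_ne_zero, fun P => ?_⟩
    rw [map_one, ordAt_one h2]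
    rcases exists_eq_affinePoint_or P with ⟨x₀, y₀, h, rfl⟩ | ⟨y₀, h, rfl⟩
    · rw [poleOrd_affinePoint h2, if_neg affinePoint_ne_infinitePoint, add_zero]
    · obtain rfl : y₀ = 0 := by
        rw [← h₁] at h
        simpa using h
      rw [poleOrd_infinitePoint h2, ordAt_x_infinitePoint h2]
      simp

/-- A function without poles at the affine points is a polynomial in `x` and `y`. -/
theorem exists_eq_ofX_add_of_ordAt_nonneg [IsAlgClosed K] (h2 : (2 : K) ≠ 0)
    {g : H.FunctionField} (hg : g ≠ 0)
    (hord : ∀ x₀ y₀ h, 0 ≤ H.ordAt (H.affinePoint x₀ y₀ h) g) :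
    ∃ a b, g = H.ofX a + H.ofX b * H.y := by
  -- The degree of the denominator is lowered as long as it has a root.
  suffices H' : ∀ (n : ℕ) (a b c : K[X]), c ≠ 0 → c.natDegree = n →
      g = (H.ofX a + H.ofX b * H.y) / H.ofX c → ∃ a b, g = H.ofX a + H.ofX b * H.y by
    obtain ⟨a, b, c, hc, hg⟩ := exists_eq_ofX_div g
    exact H' _ a b c hc rfl hg
  intro n
  induction n with
  | zero =>
    intro a b c hc hn hgc
    obtain ⟨r, rfl⟩ := natDegree_eq_zero.mp hn
    have hr : r ≠ 0 := by simpa using hc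
    refine ⟨a * C r⁻¹, b * C r⁻¹, ?_⟩
    have h1 : H.ofX (C r⁻¹) * H.ofX (C r) = 1 := by
      rw [← map_mul, ← C_mul, inv_mul_cancel₀ hr, C_1, map_one]
    rw [hgc, div_eq_iff (ofX_ne_zero hc), map_mul, map_mul]
    linear_combination -(H.ofX a + H.ofX b * H.y) * h1
  | succ n ih =>
    intro a b c hc hn hgc
    obtain ⟨x₀, hx₀⟩ := IsAlgClosed.exists_root c (degree_ne_of_natDegree_ne (n := 0) (by omega))
    obtain ⟨c₁, rfl⟩ := dvd_iff_isRoot.mpr hx₀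
    have hc₁ : c₁ ≠ 0 := right_ne_zero_of_mul hc
    obtain ⟨y₀, hy₀⟩ := IsAlgClosed.exists_pow_nat_eq (H.F.eval x₀) two_pos
    have hmul : g * H.ofX c₁ = (H.ofX a + H.ofX b * H.y) / H.ofX (X - C x₀) := by
      have := H.ofX_ne_zero hc₁
      have := H.ofX_ne_zero (X_sub_C_ne_zero x₀)
      rw [hgc, map_mul]
      field_simp
    have hmem : ∀ y (h : y ^ 2 = H.F.eval x₀), (H.ofX a + H.ofX b * H.y) / H.ofX (X - C x₀) ∈
        H.localRing (H.affinePoint x₀ y h) := by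
      intro y h
      obtain ⟨t, ht⟩ := exists_isUniformizer h2 (H.affinePoint x₀ y h)
      rw [← hmul]
      exact Subring.mul_mem _ (mem_localRing_of_ordAt_nonneg ht hg (hord _ _ _))
        ((isChartAt_affinePoint x₀ y h).map_mem c₁)
    obtain ⟨ha, hb⟩ := (isChartAt_affinePoint x₀ y₀ hy₀).eval_eq_zero_and h2
      (isChartAt_affinePoint x₀ (-y₀) (by rwa [neg_sq])) (hmem _ _) (hmem _ _)
    obtain ⟨a₁, rfl⟩ := dvd_iff_isRoot.mpr ha
    obtain ⟨b₁, rfl⟩ := dvd_iff_isRoot.mpr hb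
    refine ih a₁ b₁ c₁ hc₁ ?_ ?_
    · rw [natDegree_mul (X_sub_C_ne_zero x₀) hc₁, natDegree_X_sub_C] at hn
      omega
    · have := H.ofX_ne_zero (X_sub_C_ne_zero x₀)
      rw [hgc, map_mul, map_mul, map_mul, mul_assoc, ← mul_add, mul_div_mul_left _ _ this]

/-- A function whose poles are bounded by those of a form of degree `m ≤ 3` in `u, v` is a
polynomial in `x`: the function `y = w / v⁴` has too large a pole at infinity. -/
theorem exists_eq_ofX_of_mul_poleOrd_le [IsAlgClosed K] (h2 : (2 : K) ≠ 0)
    {g : H.FunctionField} (hg : g ≠ 0) {m : ℕ} (hm : m ≤ 3)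
    (hord : ∀ P, m * H.poleOrd P ≤ H.ordAt P g) : ∃ a, g = H.ofX a := by
  obtain ⟨a, b, hab⟩ := exists_eq_ofX_add_of_ordAt_nonneg h2 hg fun x₀ y₀ h => by
    simpa [poleOrd_affinePoint h2] using hord (H.affinePoint x₀ y₀ h)
  by_cases hb : b = 0
  · exact ⟨a, by simpa [hb] using hab⟩
  exfalso
  have hx := x_ne_zero (H := H)
  -- `g / x ^ (N + 4)` is a polynomial in `1 / x` and `y / x⁴` that would vanish to order at least
  -- `4 - m` at infinity, but one of its coefficients at infinity is nonzero.
  obtain ⟨N, hN⟩ : ∃ N, N = max (a.natDegree - 4) b.natDegree := ⟨_, rfl⟩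
  have hquot : (H.ofInvX (reflect (N + 4) a) + H.ofInvX (reflect N b) * H.yInf) /
      H.ofInvX (X - C 0) = g * (H.x ^ (N + 3))⁻¹ := by
    rw [hab, ← ofInvX_reflect (H := H) (a := a) (N := N + 4) (by omega),
      ← ofInvX_reflect (H := H) (a := b) (N := N) (by omega), C_0, sub_zero, ofInvX_X, yInf]
    field_simp
    ring
  obtain ⟨y₀, hy₀⟩ := IsAlgClosed.exists_pow_nat_eq (H.F.coeff 8) two_pos
  have hmem : ∀ y (h : y ^ 2 = H.F.coeff 8),
      (H.ofInvX (reflect (N + 4) a) + H.ofInvX (reflect N b) * H.yInf) / H.ofInvX (X - C 0) ∈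
        H.localRing (H.infinitePoint y h) := by
    intro y h
    obtain ⟨t, ht⟩ := exists_isUniformizer h2 (H.infinitePoint y h)
    have hp := pow_ne_zero (N + 3) hx
    rw [hquot]
    refine mem_localRing_of_ordAt_nonneg ht (mul_ne_zero hg (inv_ne_zero hp)) ?_
    rw [ordAt_mul h2 _ hg (inv_ne_zero hp), ordAt_inv h2 _ hp, ordAt_pow h2 _ hx,
      ← poleOrd_infinitePoint h2]
    have h1 := hord (H.infinitePoint y h)
    have h3 := poleOrd_nonpos (H.infinitePoint y h)
    push_cast
    nlinarith [mul_nonneg_of_nonpos_of_nonpos h3 (show (m : ℤ) - (N + 3) ≤ 0 by omega)]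
  obtain ⟨ha0, hb0⟩ := (isChartAt_infinitePoint y₀ hy₀).eval_eq_zero_and h2
    (isChartAt_infinitePoint (-y₀) (by rwa [neg_sq])) (hmem _ _) (hmem _ _)
  rw [coeff_zero_reflect] at ha0 hb0
  rcases le_total (a.natDegree - 4) b.natDegree with h | h
  · rw [hN, max_eq_right h, coeff_natDegree, leadingCoeff_eq_zero] at hb0
    exact hb hb0
  · rw [max_eq_left h] at hN
    by_cases h4 : a.natDegree ≤ 4
    · refine hb (leadingCoeff_eq_zero.mp ?_)
      rw [leadingCoeff, ← hb0]
      congr 1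
      omega
    · have : a = 0 := by
        rw [← leadingCoeff_eq_zero, leadingCoeff, ← ha0]
        congr 1
        omega
      simp [this] at h4

end HyperellipticCurve3

namespace HyperellipticCurve3

variable {K : Type*} [Field K] {H : HyperellipticCurve3 K}

/-! ### Relations between divisor classes -/

/-- Since orders are additive, the divisors of functions already form a group. -/
theorem mem_principalDivisors_iff (h2 : (2 : K) ≠ 0) (D : H.Divisor) :
    D ∈ H.principalDivisors ↔ ∃ f, f ≠ 0 ∧ H.IsDivOf D f := by
  refine ⟨fun h => ?_, fun h => AddSubgroup.subset_closure h⟩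
  induction h using AddSubgroup.closure_induction with
  | mem D h => exact h
  | zero => exact ⟨1, one_ne_zero, fun P => by rw [ordAt_one h2]; rfl⟩
  | add D E _ _ hD hE =>
    obtain ⟨f, hf, hD⟩ := hD
    obtain ⟨g, hg, hE⟩ := hE
    exact ⟨f * g, mul_ne_zero hf hg, fun P => by rw [ordAt_mul h2 P hf hg, ← hD, ← hE]; rfl⟩
  | neg D _ hD =>
    obtain ⟨f, hf, hD⟩ := hD
    exact ⟨f⁻¹, inv_ne_zero hf, fun P => by rw [ordAt_inv h2 P hf, ← hD]; rfl⟩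

open Classical in
/-- A combination of classes vanishes exactly if the same combination of divisors is the divisor of a
function. -/
theorem sum_zsmul_pointDiffClass_eq_zero_iff (h2 : (2 : K) ≠ 0) {ι : Type*} [Fintype ι]
    (n : ι → ℤ) (W' W'' : ι → H.Point) :
    ∑ i, n i • H.pointDiffClass (W' i) (W'' i) = 0 ↔ ∃ f, f ≠ 0 ∧ ∀ P, H.ordAt P f =
      ∑ i, n i * ((if P = W' i then 1 else 0) - if P = W'' i then 1 else 0) := by
  have h1 : ∑ i, n i • H.pointDiffClass (W' i) (W'' i) =
      (QuotientAddGroup.mk (∑ i, n i • H.pointDiff (W' i) (W'' i)) : H.Jacobian) := by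
    rw [← QuotientAddGroup.mk'_apply, map_sum]
    rfl
  rw [h1, QuotientAddGroup.eq_zero_iff, AddSubgroup.mem_addSubgroupOf,
    mem_principalDivisors_iff h2]
  refine exists_congr fun f => and_congr_right fun _ => forall_congr' fun P => ?_
  rw [eq_comm]
  simp [pointDiff, Finsupp.single_apply, Finsupp.finsetSum_apply, eq_comm]

theorem pointDiffClass_swap (P Q : H.Point) : H.pointDiffClass Q P = -H.pointDiffClass P Q := by
  rw [pointDiffClass, pointDiffClass, ← QuotientAddGroup.mk_neg]
  congr 1
  exact Subtype.ext (neg_sub _ _).symm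

/-- Twice the class of a difference of Weierstrass points is the class of the divisor of a quotient
of two linear forms. -/
theorem two_zsmul_pointDiffClass (h2 : (2 : K) ≠ 0) {W' W'' : H.Point}
    (h' : W' ∈ H.weierstrassPoints) (h'' : W'' ∈ H.weierstrassPoints) :
    (2 : ℤ) • H.pointDiffClass W' W'' = 0 := by
  have h := sum_zsmul_pointDiffClass_eq_zero_iff h2 (fun _ : Unit => 2) (fun _ => W') fun _ => W''
  rw [Fintype.sum_unique] at h
  obtain ⟨l', hl', hl'ord⟩ := exists_ordAt_ofX_eq h2 h'
  obtain ⟨l'', hl'', hl''ord⟩ := exists_ordAt_ofX_eq h2 h''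
  refine h.mpr ⟨H.ofX l' / H.ofX l'', div_ne_zero (ofX_ne_zero hl') (ofX_ne_zero hl''), fun P => ?_⟩
  rw [ordAt_div h2 P (ofX_ne_zero hl') (ofX_ne_zero hl''), hl'ord, hl''ord, Fintype.sum_unique]
  split_ifs <;> ring

theorem zsmul_pointDiffClass_congr (h2 : (2 : K) ≠ 0) {W' W'' : H.Point}
    (h' : W' ∈ H.weierstrassPoints) (h'' : W'' ∈ H.weierstrassPoints) {m n : ℤ}
    (hmn : m ≡ n [ZMOD 2]) : m • H.pointDiffClass W' W'' = n • H.pointDiffClass W' W'' := by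
  obtain ⟨c, hc⟩ := hmn.dvd
  obtain rfl : n = m + c * 2 := by omega
  rw [add_zsmul, mul_zsmul, two_zsmul_pointDiffClass h2 h' h'', zsmul_zero, add_zero]

/-- The sum of the classes `[(W') - (W'')]` over a pairing of the Weierstrass points is the class of
the divisor of `w / ∏ l_{W''}`, where `l_{W''}` is a linear form with divisor `2 W''`. -/
theorem sum_pointDiffClass_eq_zero (h2 : (2 : K) ≠ 0) {W' W'' : Fin 4 → H.Point}
    (hinj : Function.Injective (Sum.elim W' W''))
    (hrange : Set.range (Sum.elim W' W'') = H.weierstrassPoints) :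
    ∑ i, H.pointDiffClass (W' i) (W'' i) = 0 := by
  classical
  have h := sum_zsmul_pointDiffClass_eq_zero_iff h2 (fun _ => 1) W' W''
  simp only [one_zsmul] at h
  have hW'' : ∀ i, W'' i ∈ H.weierstrassPoints := fun i => hrange ▸ ⟨Sum.inr i, rfl⟩
  choose l hl hlord using fun i => exists_ordAt_ofX_eq h2 (hW'' i)
  have hl' : ∀ i, H.ofX (l i) ≠ 0 := fun i => ofX_ne_zero (hl i)
  have hprod : ∏ i, H.ofX (l i) ≠ 0 := Finset.prod_ne_zero_iff.mpr fun i _ => hl' i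
  refine h.mpr ⟨H.y / ∏ i, H.ofX (l i), div_ne_zero y_ne_zero hprod, fun P => ?_⟩
  have hsum : (if P ∈ H.weierstrassPoints then (1 : ℤ) else 0) =
      ∑ i, (if P = W' i then 1 else 0) + ∑ i, if P = W'' i then 1 else 0 := by
    rw [← hrange]
    refine Eq.trans ?_ (Fintype.sum_sum_type fun s => if P = Sum.elim W' W'' s then (1 : ℤ) else 0)
    split_ifs with hP
    · obtain ⟨s, rfl⟩ := hP
      simp [hinj.eq_iff]
    · exact (Finset.sum_eq_zero fun s _ => if_neg fun hs => hP ⟨s, hs.symm⟩).symm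
  rw [ordAt_div h2 P y_ne_zero hprod, ordAt_y h2, ordAt_prod h2 P _ _ hl', hsum]
  simp only [hlord, Finset.sum_add_distrib, Finset.sum_const, Finset.card_univ, Fintype.card_fin,
    one_mul, Finset.sum_sub_distrib]
  have h3 : ∑ i, (if P = W'' i then (2 : ℤ) else 0) = 2 * ∑ i, if P = W'' i then 1 else 0 := by
    rw [Finset.mul_sum]
    exact Finset.sum_congr rfl fun i _ => by split_ifs <;> rfl
  rw [h3]
  simp
  ring

/-- The sum of the classes `[(W') - (W'')]` over one, two or three of the four pairs is not zero. If
it were the divisor of `f`, then `f` times the linear forms of the points `W''` would be a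
polynomial in `x` with a zero of odd order at one of the Weierstrass points. -/
theorem sum_subset_pointDiffClass_ne_zero [IsAlgClosed K] (h2 : (2 : K) ≠ 0)
    {W' W'' : Fin 4 → H.Point} (hinj : Function.Injective (Sum.elim W' W''))
    (hrange : Set.range (Sum.elim W' W'') = H.weierstrassPoints) {I : Finset (Fin 4)}
    (hI : I.Nonempty) (hI' : I ≠ Finset.univ) :
    ∑ i ∈ I, H.pointDiffClass (W' i) (W'' i) ≠ 0 := by
  classical
  intro h0
  rw [← Finset.sum_coe_sort] at h0
  have h := sum_zsmul_pointDiffClass_eq_zero_iff h2 (fun _ => 1) (fun i : I => W' i) fun i => W'' i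
  simp only [one_zsmul, one_mul] at h
  obtain ⟨f, hf, hford⟩ := h.mp h0
  have hW'' : ∀ i, W'' i ∈ H.weierstrassPoints := fun i => hrange ▸ ⟨Sum.inr i, rfl⟩
  choose l hl hlord using fun i => exists_ordAt_ofX_eq h2 (hW'' i)
  have hl' : ∀ i, H.ofX (l i) ≠ 0 := fun i => ofX_ne_zero (hl i)
  have hprod : ∏ i ∈ I, H.ofX (l i) ≠ 0 := Finset.prod_ne_zero_iff.mpr fun i _ => hl' i
  have hg := mul_ne_zero hf hprod
  have hord : ∀ P, H.ordAt P (f * ∏ i ∈ I, H.ofX (l i)) =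
      ∑ i ∈ I, ((if P = W' i then 1 else 0) + if P = W'' i then 1 else 0) +
        I.card * H.poleOrd P := by
    intro P
    rw [ordAt_mul h2 P hf hprod, ordAt_prod h2 P _ _ hl', hford,
      Finset.sum_coe_sort I fun i => (if P = W' i then (1 : ℤ) else 0) - if P = W'' i then 1 else 0,
      ← Finset.sum_add_distrib, ← nsmul_eq_mul, ← Finset.sum_const, ← Finset.sum_add_distrib]
    refine Finset.sum_congr rfl fun i _ => ?_
    rw [hlord]
    split_ifs <;> ring
  have hcard : I.card ≤ 3 := by
    by_contra hc
    refine hI' ((Finset.card_eq_iff_eq_univ I).mp ?_)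
    have := Finset.card_le_univ I
    rw [Fintype.card_fin] at this ⊢
    omega
  obtain ⟨a, ha⟩ := exists_eq_ofX_of_mul_poleOrd_le h2 hg hcard fun P => by
    rw [hord, le_add_iff_nonneg_left]
    exact Finset.sum_nonneg fun i _ => by split_ifs <;> norm_num
  have ha0 : a ≠ 0 := by
    rintro rfl
    exact hg (by rw [ha, map_zero])
  obtain ⟨j, hj⟩ := hI
  have hWj : W' j ∈ H.weierstrassPoints := hrange ▸ ⟨Sum.inl j, rfl⟩
  -- By `hord` the order at `W' j` is `1` plus an even multiple of the degree of the product.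
  have heven := even_ordAt_ofX h2 hWj ha0
  have h1 : ∀ i, W' j = W' i ↔ j = i := fun i =>
    (hinj.eq_iff (a := Sum.inl j) (b := Sum.inl i)).trans Sum.inl_injective.eq_iff
  have h3 : ∀ i, W' j ≠ W'' i := fun i hji => by
    simpa using hinj (a₁ := Sum.inl j) (a₂ := Sum.inr i) hji
  rw [← ha, hord] at heven
  simp only [h1, h3, if_false, add_zero, Finset.sum_ite_eq, hj, if_true] at heven
  have := (Int.even_add.mp heven).mpr ((even_poleOrd h2 hWj).mul_left _)
  exact Int.not_even_one this

theorem sum_zsmul_pointDiffClass_eq_zero_iff_modEq [IsAlgClosed K] (h2 : (2 : K) ≠ 0)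
    {W' W'' : Fin 4 → H.Point} (hinj : Function.Injective (Sum.elim W' W''))
    (hrange : Set.range (Sum.elim W' W'') = H.weierstrassPoints) (n : Fin 4 → ℤ) :
    ∑ i, n i • H.pointDiffClass (W' i) (W'' i) = 0 ↔ ∀ i j, n i ≡ n j [ZMOD 2] := by
  classical
  have hW' : ∀ i, W' i ∈ H.weierstrassPoints := fun i => hrange ▸ ⟨Sum.inl i, rfl⟩
  have hW'' : ∀ i, W'' i ∈ H.weierstrassPoints := fun i => hrange ▸ ⟨Sum.inr i, rfl⟩
  constructor
  · intro h0
    by_contra! hne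
    obtain ⟨i, j, hij⟩ := hne
    have hodd : ∑ i, n i • H.pointDiffClass (W' i) (W'' i) =
        ∑ i ∈ Finset.univ.filter (fun i => Odd (n i)), H.pointDiffClass (W' i) (W'' i) := by
      rw [Finset.sum_filter]
      refine Finset.sum_congr rfl fun i _ => ?_
      split_ifs with hi
      · rw [zsmul_pointDiffClass_congr h2 (hW' i) (hW'' i) (n := 1), one_zsmul]
        exact Int.odd_iff.mp hi
      · rw [zsmul_pointDiffClass_congr h2 (hW' i) (hW'' i) (n := 0), zero_zsmul]
        exact Int.even_iff.mp (Int.not_odd_iff_even.mp hi)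
    rw [hodd] at h0
    refine sum_subset_pointDiffClass_ne_zero h2 hinj hrange ?_ ?_ h0
    · by_contra hI
      rw [Finset.not_nonempty_iff_eq_empty, Finset.filter_eq_empty_iff] at hI
      have hi := Int.even_iff.mp (Int.not_odd_iff_even.mp (hI (Finset.mem_univ i)))
      have hj := Int.even_iff.mp (Int.not_odd_iff_even.mp (hI (Finset.mem_univ j)))
      exact hij (hi.trans hj.symm)
    · intro hI
      rw [Finset.filter_eq_self] at hI
      exact hij ((Int.odd_iff.mp (hI i (Finset.mem_univ i))).trans
        (Int.odd_iff.mp (hI j (Finset.mem_univ j))).symm)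
  · intro h
    calc ∑ i, n i • H.pointDiffClass (W' i) (W'' i)
        = ∑ i, n 0 • H.pointDiffClass (W' i) (W'' i) := Finset.sum_congr rfl fun i _ =>
          zsmul_pointDiffClass_congr h2 (hW' i) (hW'' i) (h i 0)
      _ = 0 := by rw [← Finset.smul_sum, sum_pointDiffClass_eq_zero h2 hinj hrange, smul_zero]

/-! ### Pairings of the Weierstrass points -/

theorem IsPairPartition.exists_eq_range {π : Set (Set H.Point)} (hπ : H.IsPairPartition π) :
    ∃ W' W'' : Fin 4 → H.Point, π = Set.range fun i => {W' i, W'' i} := by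
  have hfin : Finite π := Set.finite_of_ncard_ne_zero (by rw [hπ.ncard_eq]; norm_num)
  let e : π ≃ Fin 4 := Finite.equivFinOfCardEq hπ.ncard_eq
  choose W' W'' _ hW using fun i => Set.ncard_eq_two.mp (hπ.ncard_pair _ (e.symm i).2)
  refine ⟨W', W'', Set.ext fun B => ⟨fun hB => ⟨e ⟨B, hB⟩, ?_⟩, ?_⟩⟩
  · simp [← hW]
  · rintro ⟨i, rfl⟩
    simp only [← hW]
    exact (e.symm i).2

section Pairing

variable {π : Set (Set H.Point)} {W' W'' : Fin 4 → H.Point}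

theorem IsPairPartition.range_eq (hπ : H.IsPairPartition π)
    (h : π = Set.range fun i => {W' i, W'' i}) :
    Set.range (Sum.elim W' W'') = H.weierstrassPoints := by
  rw [← hπ.sUnion_eq, h]
  ext P
  simp [exists_or, eq_comm]

theorem IsPairPartition.injective (hπ : H.IsPairPartition π)
    (h : π = Set.range fun i => {W' i, W'' i}) : Function.Injective (Sum.elim W' W'') := by
  have hpair : Function.Injective fun i => ({W' i, W'' i} : Set H.Point) := by
    have h4 := hπ.ncard_eq
    rw [h] at h4
    refine Set.injOn_univ.mp ((Set.ncard_image_iff Set.finite_univ).mp ?_)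
    rw [Set.image_univ, h4, Set.ncard_univ, Nat.card_fin]
  have hmem : ∀ i, ({W' i, W'' i} : Set H.Point) ∈ π := fun i => h ▸ ⟨i, rfl⟩
  have hdisj : ∀ i j P, P ∈ ({W' i, W'' i} : Set H.Point) → P ∈ ({W' j, W'' j} : Set H.Point) →
      i = j := by
    intro i j P hi hj
    by_contra hij
    exact Set.disjoint_left.mp (hπ.disjoint (hmem i) (hmem j) (hpair.ne hij)) hi hj
  have hne : ∀ i, W' i ≠ W'' i := by
    intro i heq
    have := hπ.ncard_pair _ (hmem i)
    rw [heq, Set.pair_eq_singleton, Set.ncard_singleton] at this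
    omega
  rintro (i | i) (j | j) hij <;> simp only [Sum.elim_inl, Sum.elim_inr] at hij
  · rw [hdisj i j (W' i) (by simp) (by simp [hij])]
  · obtain rfl := hdisj i j (W' i) (by simp) (by simp [hij])
    exact absurd hij (hne i)
  · obtain rfl := hdisj i j (W'' i) (by simp) (by simp [hij])
    exact absurd hij.symm (hne i)
  · rw [hdisj i j (W'' i) (by simp) (by simp [hij])]

theorem partitionSubgroup_eq_closure (h : π = Set.range fun i => {W' i, W'' i}) :
    H.partitionSubgroup π =
      AddSubgroup.closure (Set.range fun i => H.pointDiffClass (W' i) (W'' i)) := by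
  refine le_antisymm ((AddSubgroup.closure_le _).mpr ?_) (AddSubgroup.closure_mono ?_)
  · rintro c ⟨P, Q, hPQ, rfl⟩
    rw [h] at hPQ
    obtain ⟨i, hi⟩ := hPQ
    have hm : H.pointDiffClass (W' i) (W'' i) ∈
        AddSubgroup.closure (Set.range fun i => H.pointDiffClass (W' i) (W'' i)) :=
      AddSubgroup.subset_closure ⟨i, rfl⟩
    rcases Set.pair_eq_pair_iff.mp hi with ⟨rfl, rfl⟩ | ⟨rfl, rfl⟩
    · exact hm
    · rw [pointDiffClass_swap]
      exact neg_mem hm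
  · rintro _ ⟨i, rfl⟩
    exact ⟨W' i, W'' i, h ▸ ⟨i, rfl⟩, rfl⟩

end Pairing

/-- A group generated by four elements whose relations are those of `(ℤ/2ℤ)⁴` modulo the diagonal is
isomorphic to `(ℤ/2ℤ)³`. -/
theorem _root_.AddSubgroup.nonempty_closure_range_addEquiv {A : Type*} [AddCommGroup A]
    (e : Fin 4 → A) (h : ∀ n : Fin 4 → ℤ, ∑ i, n i • e i = 0 ↔ ∀ i j, n i ≡ n j [ZMOD 2]) :
    Nonempty (AddSubgroup.closure (Set.range e) ≃+ (Fin 3 → ZMod 2)) := by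
  -- Compare the map `f` given by the first three generators with the reduction `r` modulo `2`.
  let f : (Fin 3 → ℤ) →+ A :=
    { toFun := fun n => ∑ i, n i • e i.castSucc
      map_zero' := by simp
      map_add' := fun m n => by simp [add_zsmul, Finset.sum_add_distrib] }
  let r : (Fin 3 → ℤ) →+ (Fin 3 → ZMod 2) :=
    { toFun := fun n i => (n i : ZMod 2)
      map_zero' := by ext; simp
      map_add' := fun m n => by ext; simp }
  have hrange : f.range = AddSubgroup.closure (Set.range e) := by
    refine le_antisymm ?_ ((AddSubgroup.closure_le _).mpr ?_)
    · rintro _ ⟨n, rfl⟩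
      change ∑ i : Fin 3, n i • e i.castSucc ∈ _
      refine sum_mem fun i _ => zsmul_mem ?_ _
      exact AddSubgroup.subset_closure ⟨i.castSucc, rfl⟩
    · rintro _ ⟨i, rfl⟩
      induction i using Fin.lastCases with
      | cast i => exact ⟨Pi.single i 1, by simp [f, Pi.single_apply, ite_smul]⟩
      | last =>
        refine ⟨fun _ => -1, ?_⟩
        have h1 := (h fun _ => 1).mpr fun _ _ => rfl
        rw [Fin.sum_univ_castSucc] at h1
        simp only [one_zsmul] at h1
        simp only [f, AddMonoidHom.coe_mk, ZeroHom.coe_mk, neg_smul, one_zsmul,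
          Finset.sum_neg_distrib]
        exact neg_eq_of_add_eq_zero_right h1
  have hker : f.ker = r.ker := by
    ext n
    have h1 := h (Fin.snoc n 0)
    rw [Fin.sum_univ_castSucc] at h1
    simp only [Fin.snoc_castSucc, Fin.snoc_last, zero_zsmul, add_zero] at h1
    rw [AddMonoidHom.mem_ker, AddMonoidHom.mem_ker]
    refine h1.trans ⟨fun hn => funext fun i => ?_, fun hn => ?_⟩
    · have := hn i.castSucc (Fin.last 3)
      rw [Fin.snoc_castSucc, Fin.snoc_last] at this
      exact (ZMod.intCast_eq_intCast_iff _ _ 2).mpr this |>.trans Int.cast_zero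
    · have h0 : ∀ i, (Fin.snoc n 0 : Fin 4 → ℤ) i ≡ 0 [ZMOD 2] := by
        intro i
        induction i using Fin.lastCases with
        | cast i =>
          rw [Fin.snoc_castSucc]
          exact (ZMod.intCast_eq_intCast_iff _ _ 2).mp ((congrFun hn i).trans Int.cast_zero.symm)
        | last => rw [Fin.snoc_last]
      exact fun i j => (h0 i).trans (h0 j).symm
  have hr : Function.Surjective r := fun z =>
    ⟨fun i => (z i).cast, funext fun i => ZMod.intCast_zmod_cast (z i)⟩
  exact ⟨((AddEquiv.addSubgroupCongr hrange).symm.trans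
    (QuotientAddGroup.quotientKerEquivRange f).symm).trans
    ((QuotientAddGroup.quotientAddEquivOfEq hker).trans
      (QuotientAddGroup.quotientKerEquivOfSurjective r hr))⟩

/-! ### The Galois action on classes of pairs -/

section Galois

variable {k L : Type*} [Field k] [PerfectField k] [Field L] [Algebra k L]
  (H : HyperellipticCurve3 k)

theorem galJacobian_pointDiffClass (σ : Gal(L/k)) (P Q : (H.baseChange L).Point) :
    H.galJacobian σ ((H.baseChange L).pointDiffClass P Q) =
      (H.baseChange L).pointDiffClass (H.galPoint σ P) (H.galPoint σ Q) := by
  change QuotientAddGroup.mk (H.galDivisorZero σ ((H.baseChange L).pointDiff P Q)) = _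
  refine congrArg _ (Subtype.ext ?_)
  change H.galDivisor σ (Finsupp.single P 1 - Finsupp.single Q 1) = _
  rw [map_sub]
  simp [galDivisor, pointDiff]

theorem map_partitionSubgroup {π : Set (Set (H.baseChange L).Point)}
    (hstable : ∀ σ : Gal(L/k), ∀ B ∈ π, H.galPoint σ '' B ∈ π) (σ : Gal(L/k)) :
    ((H.baseChange L).partitionSubgroup π).map (H.galJacobian σ) =
      (H.baseChange L).partitionSubgroup π := by
  refine le_antisymm (AddSubgroup.map_le_iff_le_comap.mpr ?_) ?_ <;>
    refine (AddSubgroup.closure_le _).mpr ?_ <;> rintro c ⟨P, Q, hPQ, rfl⟩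
  · refine AddSubgroup.subset_closure ⟨_, _, ?_, H.galJacobian_pointDiffClass σ P Q⟩
    rw [← Set.image_pair]
    exact hstable σ _ hPQ
  · refine ⟨(H.baseChange L).pointDiffClass (H.galPoint σ.symm P) (H.galPoint σ.symm Q),
      AddSubgroup.subset_closure ⟨_, _, ?_, rfl⟩, ?_⟩
    · rw [← Set.image_pair]
      exact hstable σ.symm _ hPQ
    · rw [galJacobian_pointDiffClass]
      congr 1 <;> exact H.galPoint_symm_galPoint σ.symm _

end Galois

end HyperellipticCurve3

open HyperellipticCurve3 in
theorem mainTheorem6 {k : Type*} [Field k] [Finite k] (p : ℕ) [CharP k p] (hp : 3 < p)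
    (L : Type*) [Field L] [Algebra k L] [IsAlgClosure k L] (H : HyperellipticCurve3 k)
    (π : Set (Set (H.baseChange L).Point)) (hπ : (H.baseChange L).IsPairPartition π)
    (hstable : ∀ σ : Gal(L/k), ∀ B ∈ π, H.galPoint σ '' B ∈ π) :
    (H.baseChange L).partitionSubgroup π ≤ (H.baseChange L).jacobianTwoTorsion ∧
    (∀ σ : Gal(L/k), ((H.baseChange L).partitionSubgroup π).map (H.galJacobian σ) =
      (H.baseChange L).partitionSubgroup π) ∧
    Nonempty ((H.baseChange L).partitionSubgroup π ≃+ (Fin 3 → ZMod 2)) ∧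
    ∀ W' W'' : Fin 4 → (H.baseChange L).Point,
      (π = Set.range fun i => {W' i, W'' i}) →
      (H.baseChange L).partitionSubgroup π =
        AddSubgroup.closure
          (Set.range fun i => (H.baseChange L).pointDiffClass (W' i) (W'' i)) ∧
      ∑ i, (H.baseChange L).pointDiffClass (W' i) (W'' i) = 0 ∧
      ∀ n : Fin 4 → ℤ,
        ∑ i, n i • (H.baseChange L).pointDiffClass (W' i) (W'' i) = 0 ↔
          ∀ i j, n i ≡ n j [ZMOD 2] := by
  have : IsAlgClosed L := IsAlgClosure.isAlgClosed k
  have : CharP L p := charP_of_injective_algebraMap (algebraMap k L).injective p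
  have h2 : (2 : L) ≠ 0 := fun h0 => by
    have h1 := (CharP.cast_eq_zero_iff L p 2).mp (by exact_mod_cast h0)
    exact absurd (Nat.le_of_dvd two_pos h1) (by omega)
  have hW : ∀ B ∈ π, ∀ W ∈ B, W ∈ (H.baseChange L).weierstrassPoints := fun B hB W hWB =>
    hπ.sUnion_eq ▸ Set.mem_sUnion_of_mem hWB hB
  refine ⟨(AddSubgroup.closure_le _).mpr ?_, H.map_partitionSubgroup hstable, ?_, ?_⟩
  · rintro c ⟨P, Q, hPQ, rfl⟩
    exact two_zsmul_pointDiffClass h2 (hW _ hPQ P (by simp)) (hW _ hPQ Q (by simp))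
  · obtain ⟨W', W'', h⟩ := hπ.exists_eq_range
    rw [partitionSubgroup_eq_closure h]
    exact AddSubgroup.nonempty_closure_range_addEquiv _
      (sum_zsmul_pointDiffClass_eq_zero_iff_modEq h2 (hπ.injective h) (hπ.range_eq h))
  · intro W' W'' h
    exact ⟨partitionSubgroup_eq_closure h,
      sum_pointDiffClass_eq_zero h2 (hπ.injective h) (hπ.range_eq h),
      sum_zsmul_pointDiffClass_eq_zero_iff_modEq h2 (hπ.injective h) (hπ.range_eq h)⟩
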